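/- Notation. For $p,q\in\mathbb C$ with $|p|,|q|<1$ let $(z;p,q)_\infty=\prod_{i,j\ge 0}(1-zp^iq^j)$ and let $\Gamma(z;p,q)=(pq/z;p,q)_\infty/(z;p,q)_\infty$ be the elliptic Gamma function. A sign $\pm$ in an argument means the product over both signs: $\Gamma(cx^{\pm};p,q)=\Gamma(cx;p,q)\Gamma(cx^{-1};p,q)$ and $\Gamma(cx^\pm y^\pm;p,q)=\Gamma(cxy^\pm;p,q)\,\Gamma(cx^{-1}y^\pm;p,q)$. Let $m,n\ge 1$ be integers. For $p,q,t\in\mathbb C^*=\mathbb C\setminus\{0\}$ choose square roots $p^{1/2},q^{1/2},t^{1/2}$ and write $(pqt)^{1/2}=p^{1/2}q^{1/2}t^{1/2}$, $(pqt^{-1})^{1/2}=p^{1/2}q^{1/2}t^{-1/2}$. For $a\in(\mathbb C^*)^8$ put $b=(b_0,\dots,b_7)$, $b_s=(pqt)^{1/2}a_s^{-1}$, and $$w_n(y;b|q,t)=\prod_{k=1}^n\frac{\prod_{s=0}^7\Gamma(b_sy_k^\pm;p,q)}{\Gamma(y_k^{\pm2};p,q)}\prod_{1\le k<l\le n}\frac{\Gamma(ty_k^\pm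 y_l^\pm;p,q)}{\Gamma(y_k^\pm y_l^\pm;p,q)},\qquad \Phi(x,y|q,t)=\prod_{i=1}^m\prod_{k=1}^n\Gamma\bigl((pqt^{-1})^{1/2}x_i^\pm y_k^\pm;p,q\bigr).$$ Let $\mathbb T^n=\{y\in\mathbb C^n:|y_k|=1\text{ for all }k\}$, $d\omega_n(y)=(2\pi i)^{-n}\frac{dy_1\cdots dy_n}{y_1\cdots y_n}$, and $p^{\mathbb Z_{<0}}q^{\mathbb Z_{<0}}=\{p^\mu q^\nu:\mu,\nu\in\mathbb Z_{<0}\}$, etc. Proposition. Let $R\in(0,1]$ and let $\varphi$ be holomorphic in $(\mathbb C^*)^n$. Let $\mathcal I$ be the set of all $(x,a,p^{1/2},q^{1/2},t^{1/2})$ with $p,q,t\in\mathbb C^*$, $a\in(\mathbb C^*)^8$, $x\in\mathbb T^m$, $|q|<1$, $|t|<R^2$, and $$|p|<\min(1,|q^{-1}t|),\qquad |a_s|>|(pqt)^{1/2}|\quad(0\le s\le 7).$$ On $\mathcal I$ the integral $$\psi(x;a|q,t)=\int_{\mathbb T^n}d\omega_n(y)\,w_n(y;b|q,t)\,\Phi(x,y|q,t)\,\varphi(y)$$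 is well defined (its integrand is integrable on the torus). Let $\mathcal D$ be the set of all $(x,a,p^{1/2},q^{1/2},t^{1/2})$ with $p,q,t\in\mathbb C^*$, $a\in(\mathbb C^*)^8$, $x\in(\mathbb C^*)^m$, $|q|<1$, $|t|<R^2$, satisfying the parameter conditions $$|p|<\min(1,|q^{-1}t|R^{-2}),\qquad |a_s|>|(pqt)^{1/2}|R,\qquad t\notin p^{\mathbb Z_{>0}}q^{\mathbb Z_{>0}},\qquad a_ra_s\notin p^{\mathbb Z_{>0}}q^{\mathbb Z_{>0}}t\quad(0\le r,s\le7)$$ and, for all $i\in\{1,\dots,m\}$, $s\in\{0,\dots,7\}$ and signs $\varepsilon,\varepsilon'\in\{\pm1\}$, $$|(pqt^{-1})^{1/2}|R<|x_i|<|(pqt^{-1})^{-1/2}|R^{-1},\qquad x_i^{\varepsilon}\notin a_sp^{\mathbb Z_{<0}}q^{\mathbb Z_{<0}},$$ $$x_i^{\varepsilon}x_j^{\varepsilon'}\notin p^{\mathbb Z_{<0}}q^{\mathbb Z_{<0}}t\quad(i<j\le m),\qquad x_i^{2\varepsilon}\notin p^{\mathbb Z_{<-1}}q^{\mathbb Z_{<-1}}t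 .$$ Then $\mathcal D$ is an open set containing $\mathcal I$, and $\psi$ can be continued analytically to $\mathcal D$: there is a function that is holomorphic on $\mathcal D$, jointly in $(x,a,p^{1/2},q^{1/2},t^{1/2})$, and equal to $\psi$ on $\mathcal I$. (The last condition on $x_i$ is void when $|pq|\le R^2$, in particular when $|p|<|q^{-1}t|$.) -/

import Mathlib

noncomputable section

namespace VanDiejen

/-- The double shifted factorial `(a; p, q)_∞ = ∏_{i,j ≥ 0} (1 - a p^i q^j)`. -/
def pochhammer (a p q : ℂ) : ℂ :=
  ∏' ij : ℕ × ℕ, (1 - a * p ^ ij.1 * q ^ ij.2)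

/-- The elliptic Gamma function `Γ(x; p, q) = (p q / x; p, q)_∞ / (x; p, q)_∞`. -/
def ellGamma (x p q : ℂ) : ℂ :=
  pochhammer (p * q * x⁻¹) p q / pochhammer x p q

/-- `Γ(c x^±; p, q) = Γ(c x; p, q) Γ(c x⁻¹; p, q)`. -/
def ellGammaPM (c x p q : ℂ) : ℂ :=
  ellGamma (c * x) p q * ellGamma (c * x⁻¹) p q

/-- `Γ(c x^± y^±; p, q) = Γ(c x y^±; p, q) Γ(c x⁻¹ y^±; p, q)`. -/
def ellGammaPMPM (c x y p q : ℂ) : ℂ :=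
  ellGammaPM (c * x) y p q * ellGammaPM (c * x⁻¹) y p q

/-- The weight function `w_n(y; b | q, t)` of type `BC_n` with eight parameters `b`. -/
def weight {n : ℕ} (y : Fin n → ℂ) (b : Fin 8 → ℂ) (p q t : ℂ) : ℂ :=
  (∏ k, (∏ s, ellGammaPM (b s) (y k) p q) / ellGammaPM 1 (y k ^ 2) p q) *
    ∏ k, ∏ l ∈ Finset.Ioi k,
      ellGammaPMPM t (y k) (y l) p q / ellGammaPMPM 1 (y k) (y l) p q

/-- The kernel function of Cauchy type. The half-integer powers of `p, q, t` enter through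
chosen square roots `u = p^{1/2}`, `v = q^{1/2}`, `τ = t^{1/2}`. -/
def cauchyKernel {m n : ℕ} (x : Fin m → ℂ) (y : Fin n → ℂ) (u v τ : ℂ) : ℂ :=
  ∏ i, ∏ k, ellGammaPMPM (u * v * τ⁻¹) (x i) (y k) (u ^ 2) (v ^ 2)

/-- The parameters `b_s = p^{1/2} q^{1/2} t^{1/2} / a_s`. -/
def dualParams (a : Fin 8 → ℂ) (u v τ : ℂ) : Fin 8 → ℂ :=
  fun s => u * v * τ * (a s)⁻¹

/-- The integrand `(y_1 ⋯ y_n)⁻¹ w_n(y; b | q, t) Φ(x, y | q, t) φ(y)` with respect to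
`dy_1 ⋯ dy_n`, without the factor `(2 π i)^{-n}`. -/
def integrand {m n : ℕ} (φ : (Fin n → ℂ) → ℂ) (x : Fin m → ℂ) (a : Fin 8 → ℂ) (u v τ : ℂ)
    (y : Fin n → ℂ) : ℂ :=
  (∏ k, y k)⁻¹ *
    (weight y (dualParams a u v τ) (u ^ 2) (v ^ 2) (τ ^ 2) * cauchyKernel x y u v τ * φ y)

/-- The integral transform
`ψ(x; a | q, t) = ∫_{𝕋ⁿ} dω_n(y) w_n(y; b | q, t) Φ(x, y | q, t) φ(y)`, where
`dω_n(y) = (2 π i)^{-n} dy_1 ⋯ dy_n / (y_1 ⋯ y_n)`. -/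
def cauchyTransform {m n : ℕ} (φ : (Fin n → ℂ) → ℂ) (x : Fin m → ℂ) (a : Fin 8 → ℂ)
    (u v τ : ℂ) : ℂ :=
  ((2 * (Real.pi : ℂ) * Complex.I) ^ n)⁻¹ *
    torusIntegral (integrand φ x a u v τ) (0 : Fin n → ℂ) (fun _ => (1 : ℝ))

/-- The variables `(x, a, p^{1/2}, q^{1/2}, t^{1/2})`. -/
abbrev Vars (m : ℕ) : Type := (Fin m → ℂ) × (Fin 8 → ℂ) × ℂ × ℂ × ℂ

/-- Conditions on `p, q, t` common to the initial region and to the domain of continuation. -/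
def Admissible (R : ℝ) (p q t : ℂ) : Prop :=
  p ≠ 0 ∧ q ≠ 0 ∧ t ≠ 0 ∧ ‖q‖ < 1 ∧ ‖t‖ < R ^ 2

/-- The region where the transform is defined as an integral over the torus:
`x ∈ 𝕋^m`, `|p| < min (1, |q⁻¹ t|)` and `|a_s| > |(p q t)^{1/2}|`. -/
def initialRegion (m : ℕ) (R : ℝ) : Set (Vars m) :=
  {z | match z with
    | (x, a, u, v, τ) =>
      Admissible R (u ^ 2) (v ^ 2) (τ ^ 2) ∧
      ‖u ^ 2‖ < min 1 ‖(v ^ 2)⁻¹ * τ ^ 2‖ ∧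
      (∀ s, a s ≠ 0 ∧ ‖u * v * τ‖ < ‖a s‖) ∧
      (∀ i, ‖x i‖ = 1)}

/-- The extended range of the parameters. -/
def ParamCond (R : ℝ) (a : Fin 8 → ℂ) (u v τ : ℂ) : Prop :=
  Admissible R (u ^ 2) (v ^ 2) (τ ^ 2) ∧
  ‖u ^ 2‖ < min 1 (‖(v ^ 2)⁻¹ * τ ^ 2‖ * (R ^ 2)⁻¹) ∧
  (∀ s, a s ≠ 0 ∧ ‖u * v * τ‖ * R < ‖a s‖) ∧
  (∀ μ ν : ℤ, 0 < μ → 0 < ν → τ ^ 2 ≠ (u ^ 2) ^ μ * (v ^ 2) ^ ν) ∧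
  (∀ r s, ∀ μ ν : ℤ, 0 < μ → 0 < ν → a r * a s ≠ (u ^ 2) ^ μ * (v ^ 2) ^ ν * τ ^ 2)

/-- The domain of the `x`-variables for given parameters; a sign `ε ∈ {±}` is a unit of `ℤ`. -/
def VarCond {m : ℕ} (R : ℝ) (x : Fin m → ℂ) (a : Fin 8 → ℂ) (u v τ : ℂ) : Prop :=
  (∀ i, x i ≠ 0 ∧ ‖u * v * τ⁻¹‖ * R < ‖x i‖ ∧ ‖x i‖ < ‖(u * v * τ⁻¹)⁻¹‖ * R⁻¹) ∧
  (∀ s i, ∀ ε : ℤˣ, ∀ μ ν : ℤ, μ < 0 → ν < 0 →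
    x i ^ (ε : ℤ) ≠ a s * (u ^ 2) ^ μ * (v ^ 2) ^ ν) ∧
  (∀ i j, i < j → ∀ ε ε' : ℤˣ, ∀ μ ν : ℤ, μ < 0 → ν < 0 →
    x i ^ (ε : ℤ) * x j ^ (ε' : ℤ) ≠ (u ^ 2) ^ μ * (v ^ 2) ^ ν * τ ^ 2) ∧
  (∀ i, ∀ ε : ℤˣ, ∀ μ ν : ℤ, μ < -1 → ν < -1 →
    (x i ^ (ε : ℤ)) ^ 2 ≠ (u ^ 2) ^ μ * (v ^ 2) ^ ν * τ ^ 2)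

/-- The domain of the analytic continuation, jointly in the variables and the parameters. -/
def continuationDomain (m : ℕ) (R : ℝ) : Set (Vars m) :=
  {z | match z with
    | (x, a, u, v, τ) => ParamCond R a u v τ ∧ VarCond R x a u v τ}

end VanDiejen

end

section

open Filter Topology Metric Set

/-! ### Cauchy estimates, uniform limits and parameter integrals in several complex variables. -/

section SeveralComplexVariables

variable {E : Type*} [NormedAddCommGroup E] [NormedSpace ℂ E]

/-! In each variable `y` the integrand is one and the same function `W(y)`, built from `Γ(c_j y^±)`
and the zeros of `1/Γ(y^{±2})`, where `c_j` runs over the `b_s` and `(pq/t)^{1/2} x_i^{±1}`. What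
couples the variables is a factor holomorphic for `σ < |y_k| < σ⁻¹` as soon as `|t| < σ²`. The poles
of `W` are the inner points `c_j p^μ q^ν` and the outer points, their inverses. On the large domain
`|c_j| R < 1`, so inner poles lie in `|y| < R⁻¹` and outer poles in `|y| > R`, but no circle need
separate them.

Instead of deforming a contour, the proof splits `W = f₁ + f₂` with no inner poles in `f₁` and no
outer poles in `f₂`, and integrates `f₁` over `|y| = R` and `f₂` over `|y| = R⁻¹`, iterating over
the variables. The result is holomorphic in the parameters whenever the splitting is.

A local splitting (`exists_local_decomposition`) is a partial fraction expansion: with `P`, `Q` the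
finite products of linear factors vanishing at the relevant inner and outer poles, the numerator has
to lie in the ideal `(P, Q)`. A pair of poles `α`, `1/β` with `αβ ≠ 1` makes `1` a combination of
its two factors. Pairs with `αβ = 1` do occur in the domain, but only for two poles of one family
`(pq/t)^{1/2} x_i^ε p^μ q^ν` lying on a common axis `μ = 0` or `ν = 0`. There `y² = α/β` is a power
of `p` or `q`, a zero of `1/Γ(y^{±2})`, and this zero replaces the missing invertibility
(`holComb_of_sq`). Distinct pairs use distinct zeros (`injOn_compensatingZero`), so the numerator
suffices for all of them at once.

If inner and outer poles are disjoint, the value does not depend on the splitting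
(`splitIntegral_eq_splitIntegral`). Such parameters are dense (`subset_closure_unpinched`), so by
continuity the local functions glue. On the initial region all `|c_j| < 1`, both circles move to the
unit circle, and the torus integral reappears. -/

theorem DifferentiableOn.finset_prod_of_normed {ι : Type*} (B : Finset ι) {f : ι → E → ℂ} {s : Set E}
    (hf : ∀ i ∈ B, DifferentiableOn ℂ (f i) s) :
    DifferentiableOn ℂ (fun z => ∏ i ∈ B, f i z) s := by
  classical
  intro z hz
  exact (HasFDerivWithinAt.finsetProd
    fun i hi => (hf i hi z hz).hasFDerivWithinAt).differentiableWithinAt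

/-- Schwarz-type estimate: `f` maps the ball into the ball of radius `2M` about `f z`, whence the
factor `2`. -/
theorem norm_fderiv_le_of_forall_ball_norm_le {f : E → ℂ} {z : E} {r M : ℝ} (hr : 0 < r)
    (hf : DifferentiableOn ℂ f (ball z r)) (hM : ∀ w ∈ ball z r, ‖f w‖ ≤ M) :
    ‖fderiv ℂ f z‖ ≤ (2 * M) / r := by
  refine Complex.norm_fderiv_le_div_of_mapsTo_ball hf (fun w hw => ?_) hr
  rw [mem_closedBall, dist_eq_norm]
  calc ‖f w - f z‖ ≤ ‖f w‖ + ‖f z‖ := norm_sub_le _ _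
    _ ≤ 2 * M := by linarith [hM w hw, hM z (mem_ball_self hr)]

theorem norm_fderiv_sub_fderiv_le_of_forall_ball {f g : E → ℂ} {z : E} {r M : ℝ} (hr : 0 < r)
    (hf : DifferentiableOn ℂ f (ball z r)) (hg : DifferentiableOn ℂ g (ball z r))
    (hM : ∀ w ∈ ball z r, ‖f w - g w‖ ≤ M) :
    ‖fderiv ℂ f z - fderiv ℂ g z‖ ≤ (2 * M) / r := by
  have hz : ball z r ∈ 𝓝 z := ball_mem_nhds z hr
  rw [← fderiv_fun_sub (hf.differentiableAt hz) (hg.differentiableAt hz)]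
  exact norm_fderiv_le_of_forall_ball_norm_le hr (hf.fun_sub hg) hM

/-- A uniform limit of holomorphic functions of several complex variables is holomorphic. -/
theorem TendstoUniformlyOn.differentiableOn_of_isOpen {ι : Type*} {l : Filter ι} [l.NeBot]
    {F : ι → E → ℂ} {f : E → ℂ} {V : Set E} (hV : IsOpen V)
    (hF : ∀ i, DifferentiableOn ℂ (F i) V) (h : TendstoUniformlyOn F f l V) :
    DifferentiableOn ℂ f V := by
  intro x hx
  obtain ⟨r, hr, hrV⟩ := Metric.isOpen_iff.1 hV x hx
  have hball : ∀ z ∈ ball x (r / 2), ball z (r / 2) ⊆ V := fun z hz =>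
    (ball_subset_ball' (by rw [mem_ball] at hz; linarith)).trans hrV
  have hsub : ball x (r / 2) ⊆ V := (ball_subset_ball (by linarith)).trans hrV
  -- Cauchy's estimate on balls of radius `r/2` turns uniform closeness of the functions into
  -- uniform closeness of their derivatives.
  have hC : UniformCauchySeqOn (fun i => fderiv ℂ (F i)) l (ball x (r / 2)) := by
    intro u hu
    obtain ⟨ε, hε, hεu⟩ := Metric.mem_uniformity_dist.1 hu
    have h1 := h.uniformCauchySeqOn _ (Metric.dist_mem_uniformity (show 0 < ε * r / 8 by positivity))
    filter_upwards [h1] with m hm z hz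
    apply hεu
    rw [dist_eq_norm]
    refine (norm_fderiv_sub_fderiv_le_of_forall_ball (half_pos hr) ((hF _).mono (hball z hz))
      ((hF _).mono (hball z hz)) (M := ε * r / 8) fun w hw => ?_).trans_lt ?_
    · have := hm w (hball z hz hw)
      simp only [dist_eq_norm] at this
      exact this.le
    · field_simp
      linarith
  have hlim : ∀ z ∈ ball x (r / 2), ∃ L, Tendsto (fun i => fderiv ℂ (F i) z) l (𝓝 L) :=
    fun z hz => cauchy_map_iff_exists_tendsto.1 (hC.cauchy_map hz)
  choose! g' hg' using hlim
  have hx' : x ∈ ball x (r / 2) := mem_ball_self (half_pos hr)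
  exact (hasFDerivAt_of_tendstoUniformlyOn isOpen_ball (hC.tendstoUniformlyOn_of_tendsto hg')
    (fun i z hz => ((hF i).differentiableAt (hV.mem_nhds (hsub hz))).hasFDerivAt)
    (fun z hz => h.tendsto_at (hsub hz)) hx').differentiableAt.differentiableWithinAt

/-- A circle integral depends holomorphically on parameters. -/
theorem differentiableOn_circleIntegral_param [ProperSpace E] {g : ℂ × E → ℂ} {Ω : Set (ℂ × E)}
    (hg : DifferentiableOn ℂ g Ω) {V : Set E} (hV : IsOpen V) {r : ℝ}
    (hr : 0 ≤ r) (hsub : ∀ y ∈ sphere (0 : ℂ) r, ∀ z ∈ V, (y, z) ∈ Ω) :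
    DifferentiableOn ℂ (fun z => ∮ y in C(0, r), g (y, z)) V := by
  intro z₀ hz₀
  obtain ⟨δ', hδ', hδV'⟩ := Metric.isOpen_iff.1 hV z₀ hz₀
  obtain ⟨δ, hδ, hδV⟩ : ∃ δ > 0, closedBall z₀ (2 * δ) ⊆ V :=
    ⟨δ' / 4, by positivity, (closedBall_subset_ball (by linarith)).trans hδV'⟩
  set K : Set (ℂ × E) := sphere (0 : ℂ) r ×ˢ closedBall z₀ (2 * δ) with hK
  have hKc : IsCompact K := (isCompact_sphere _ _).prod (isCompact_closedBall _ _)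
  have hKΩ : K ⊆ Ω := fun w hw => hsub w.1 hw.1 w.2 (hδV hw.2)
  have hgK : ContinuousOn g K := hg.continuousOn.mono hKΩ
  obtain ⟨M, hM⟩ := hKc.exists_bound_of_continuousOn hgK
  have hball : ∀ z ∈ ball z₀ δ, ball z δ ⊆ closedBall z₀ (2 * δ) := fun z hz =>
    (ball_subset_ball' (by rw [mem_ball] at hz; linarith)).trans ball_subset_closedBall
  have hslice : ∀ y ∈ sphere (0 : ℂ) r, DifferentiableOn ℂ (fun z => g (y, z)) V := fun y hy =>
    hg.comp (by fun_prop) fun z hz => hsub y hy z hz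
  have hcirc : ∀ θ : ℝ, circleMap 0 r θ ∈ sphere (0 : ℂ) r := fun θ => circleMap_mem_sphere 0 hr θ
  have hscont : ∀ z ∈ V, Continuous fun θ : ℝ => g (circleMap 0 r θ, z) := fun z hz =>
    hg.continuousOn.comp_continuous (by fun_prop) fun θ => hsub _ (hcirc θ) z hz
  -- `Ω` need not be open, so no joint derivative is available. Uniform continuity of `g` on `K`
  -- makes neighbouring slices uniformly close, and Cauchy's estimate passes this on to their
  -- derivatives.
  have hcont : ContinuousOn (fun y => fderiv ℂ (fun z => g (y, z)) z₀) (sphere (0 : ℂ) r) := by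
    have hu := hKc.uniformContinuousOn_of_continuous hgK
    rw [Metric.uniformContinuousOn_iff] at hu
    rw [Metric.continuousOn_iff]
    intro y hy ε hε
    obtain ⟨η, hη, hη'⟩ := hu (ε * δ / 4) (by positivity)
    refine ⟨η, hη, fun y' hy' hd => ?_⟩
    rw [dist_eq_norm]
    have hz₀' := hball z₀ (mem_ball_self hδ)
    refine (norm_fderiv_sub_fderiv_le_of_forall_ball hδ ((hslice y' hy').mono (hz₀'.trans hδV))
      ((hslice y hy).mono (hz₀'.trans hδV)) (M := ε * δ / 4) fun w hw => ?_).trans_lt ?_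
    · rw [← dist_eq_norm]
      refine (hη' (y', w) ⟨hy', hz₀' hw⟩ (y, w) ⟨hy, hz₀' hw⟩ ?_).le
      simpa [Prod.dist_eq, hη] using hd
    · field_simp
      linarith
  have hdm : Continuous fun θ : ℝ => deriv (circleMap 0 r) θ := by
    simp only [deriv_circleMap]; fun_prop
  have hdn : ∀ θ : ℝ, ‖deriv (circleMap 0 r) θ‖ = r := fun θ => by
    simp [deriv_circleMap, abs_of_nonneg hr]
  have key : HasFDerivAt (fun z => ∫ θ in Icc 0 (2 * Real.pi),
      deriv (circleMap 0 r) θ • g (circleMap 0 r θ, z))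
      (∫ θ in Icc 0 (2 * Real.pi),
        deriv (circleMap 0 r) θ • fderiv ℂ (fun z => g (circleMap 0 r θ, z)) z₀) z₀ := by
    refine hasFDerivAt_integral_of_dominated_of_fderiv_le (ball_mem_nhds z₀ hδ)
      (F' := fun z θ => deriv (circleMap 0 r) θ • fderiv ℂ (fun z => g (circleMap 0 r θ, z)) z)
      (bound := fun _ => r * (2 * M / δ)) ?_ ?_ ?_ ?_ ?_ ?_
    · filter_upwards [hV.mem_nhds hz₀] with z hz
      exact (hdm.smul (hscont z hz)).aestronglyMeasurable
    · exact (hdm.smul (hscont z₀ hz₀)).integrableOn_Icc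
    · exact (hdm.smul (hcont.comp_continuous (by fun_prop) hcirc)).aestronglyMeasurable
    · refine Eventually.of_forall fun θ z hz => ?_
      rw [norm_smul, hdn]
      refine mul_le_mul_of_nonneg_left ?_ hr
      exact norm_fderiv_le_of_forall_ball_norm_le hδ
        ((hslice _ (hcirc θ)).mono ((hball z hz).trans hδV))
        fun w hw => hM _ ⟨hcirc θ, hball z hz hw⟩
    · exact continuous_const.integrableOn_Icc
    · refine Eventually.of_forall fun θ z hz => ?_
      have hz' : z ∈ V := hδV (hball z hz (mem_ball_self hδ))
      exact (((hslice _ (hcirc θ)).differentiableAt (hV.mem_nhds hz')).hasFDerivAt).const_smul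
        (deriv (circleMap 0 r) θ)
  simp only [circleIntegral_def_Icc]
  exact key.differentiableAt.differentiableWithinAt

end SeveralComplexVariables

namespace VanDiejen

/-! ### Double shifted factorials restricted to a set of exponents. -/

noncomputable section PartialProducts

/-- The part of the double shifted factorial `(a; p, q)_∞` with exponents in `S`. -/
def pochOn (S : Set (ℕ × ℕ)) (a p q : ℂ) : ℂ :=
  ∏' ij : ℕ × ℕ, (1 + S.indicator (fun ij => -(a * p ^ ij.1 * q ^ ij.2)) ij)

theorem pochhammer_eq_pochOn_univ (a p q : ℂ) : pochhammer a p q = pochOn univ a p q := by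
  simp [pochhammer, pochOn, sub_eq_add_neg]

variable {S T : Set (ℕ × ℕ)} {a p q : ℂ}

theorem summable_norm_indicator_pochhammer (S : Set (ℕ × ℕ)) (a : ℂ) (hp : ‖p‖ < 1)
    (hq : ‖q‖ < 1) :
    Summable fun ij : ℕ × ℕ => ‖S.indicator (fun ij => -(a * p ^ ij.1 * q ^ ij.2)) ij‖ := by
  have h : Summable fun ij : ℕ × ℕ => ‖a‖ * (‖p‖ ^ ij.1 * ‖q‖ ^ ij.2) :=
    ((summable_geometric_of_lt_one (norm_nonneg _) hp).mul_of_nonneg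
      (summable_geometric_of_lt_one (norm_nonneg _) hq) (fun _ => by positivity)
      (fun _ => by positivity)).mul_left _
  refine h.of_nonneg_of_le (fun _ => norm_nonneg _) fun ij => (norm_indicator_le_norm_self _ _).trans ?_
  simp [mul_assoc]

theorem multipliable_pochOn (S : Set (ℕ × ℕ)) (a : ℂ) (hp : ‖p‖ < 1) (hq : ‖q‖ < 1) :
    Multipliable fun ij : ℕ × ℕ => 1 + S.indicator (fun ij => -(a * p ^ ij.1 * q ^ ij.2)) ij :=
  multipliable_one_add_of_summable (summable_norm_indicator_pochhammer S a hp hq)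

/-- An absolutely convergent product vanishes only when one of its factors does. This translates the
exclusion of lattices `p^ℤ q^ℤ` into nonvanishing of holomorphic functions. -/
theorem pochOn_ne_zero_iff (hp : ‖p‖ < 1) (hq : ‖q‖ < 1) :
    pochOn S a p q ≠ 0 ↔ ∀ ij ∈ S, a * p ^ ij.1 * q ^ ij.2 ≠ 1 := by
  constructor
  · intro h ij hij h1
    refine h (tprod_of_exists_eq_zero ⟨ij, ?_⟩)
    simp [indicator_of_mem hij, h1]
  · intro h
    refine tprod_one_add_ne_zero_of_summable (fun ij => ?_)
      (summable_norm_indicator_pochhammer S a hp hq)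
    by_cases hij : ij ∈ S
    · rw [indicator_of_mem hij, ← sub_eq_add_neg]
      exact sub_ne_zero.2 (h ij hij).symm
    · simp [indicator_of_notMem hij]

theorem pochOn_mul_pochOn (hST : Disjoint S T) (a : ℂ) (hp : ‖p‖ < 1) (hq : ‖q‖ < 1) :
    pochOn S a p q * pochOn T a p q = pochOn (S ∪ T) a p q := by
  rw [pochOn, pochOn, ← (multipliable_pochOn S a hp hq).tprod_mul (multipliable_pochOn T a hp hq),
    pochOn]
  refine tprod_congr fun ij => ?_
  rw [indicator_union_of_disjoint hST]
  by_cases h : ij ∈ S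
  · simp [h, disjoint_left.1 hST h]
  · simp [h]

theorem pochOn_finset (B : Finset (ℕ × ℕ)) (a p q : ℂ) :
    pochOn (B : Set (ℕ × ℕ)) a p q = ∏ ij ∈ B, (1 - a * p ^ ij.1 * q ^ ij.2) := by
  rw [pochOn, tprod_eq_prod (s := B)]
  · exact Finset.prod_congr rfl fun ij h => by simp [h, sub_eq_add_neg]
  · intro ij h
    simp [h]

theorem pochOn_image_succ (a p q : ℂ) :
    pochOn {ij | 0 < ij.1 ∧ 0 < ij.2} a p q = pochOn univ (p * q * a) p q := by
  let s : ℕ × ℕ → ℕ × ℕ := fun ij => (ij.1 + 1, ij.2 + 1)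
  have hs : Function.Injective s := fun x y h => by
    simp only [s, Prod.mk.injEq, add_left_inj] at h
    exact Prod.ext h.1 h.2
  rw [pochOn, pochOn, ← hs.tprod_eq]
  · refine tprod_congr fun ij => ?_
    simp only [s, indicator_univ]
    rw [indicator_of_mem (by simp)]
    ring
  · intro ij hij
    by_contra h
    refine hij ?_
    dsimp only
    rw [indicator_of_notMem, add_zero]
    rintro ⟨h1, h2⟩
    refine h ⟨(ij.1 - 1, ij.2 - 1), ?_⟩
    simp only [s]
    ext <;> simp <;> omega

/-- Weierstrass M-test on a polydisc with majorant `A ρ^i ρ^j`, followed by holomorphy of uniform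
limits. -/
theorem differentiableOn_pochOn_uncurried (S : Set (ℕ × ℕ)) :
    DifferentiableOn ℂ (fun w : ℂ × ℂ × ℂ => pochOn S w.1 w.2.1 w.2.2)
      {w | ‖w.2.1‖ < 1 ∧ ‖w.2.2‖ < 1} := by
  rintro w₀ ⟨hp, hq⟩
  obtain ⟨ρ, hρ, hρ1⟩ := exists_between (max_lt hp hq)
  obtain ⟨A, hA⟩ := exists_gt ‖w₀.1‖
  have hρ0 : 0 ≤ ρ := (norm_nonneg _).trans ((le_max_left _ _).trans hρ.le)
  set K : Set (ℂ × ℂ × ℂ) := closedBall 0 A ×ˢ closedBall 0 ρ ×ˢ closedBall 0 ρ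
  set V : Set (ℂ × ℂ × ℂ) := ball 0 A ×ˢ ball 0 ρ ×ˢ ball 0 ρ
  have hVK : V ⊆ K :=
    prod_mono ball_subset_closedBall (prod_mono ball_subset_closedBall ball_subset_closedBall)
  have hK : IsCompact K :=
    (isCompact_closedBall _ _).prod ((isCompact_closedBall _ _).prod (isCompact_closedBall _ _))
  have hV : IsOpen V := isOpen_ball.prod (isOpen_ball.prod isOpen_ball)
  have hw : w₀ ∈ V := by
    simp only [V, mem_prod, mem_ball_zero_iff]
    exact ⟨hA, (le_max_left _ _).trans_lt hρ, (le_max_right _ _).trans_lt hρ⟩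
  have hdiff : ∀ ij : ℕ × ℕ, Differentiable ℂ fun w : ℂ × ℂ × ℂ =>
      S.indicator (fun ij => -(w.1 * w.2.1 ^ ij.1 * w.2.2 ^ ij.2)) ij := fun ij => by
    by_cases h : ij ∈ S
    · simp only [indicator_of_mem h]; fun_prop
    · simp only [indicator_of_notMem h]; fun_prop
  have hu : Summable fun ij : ℕ × ℕ => A * (ρ ^ ij.1 * ρ ^ ij.2) :=
    ((summable_geometric_of_lt_one hρ0 hρ1).mul_of_nonneg
      (summable_geometric_of_lt_one hρ0 hρ1) (fun _ => by positivity)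
      (fun _ => by positivity)).mul_left _
  have hprod := Summable.hasProdUniformlyOn_one_add hK hu
    (f := fun ij (w : ℂ × ℂ × ℂ) => S.indicator (fun ij => -(w.1 * w.2.1 ^ ij.1 * w.2.2 ^ ij.2)) ij)
    (Eventually.of_forall fun ij w hw => by
      simp only [K, mem_prod, mem_closedBall_zero_iff] at hw
      refine (norm_indicator_le_norm_self _ _).trans ?_
      have h1 := pow_le_pow_left₀ (norm_nonneg _) hw.2.1 ij.1
      have h2 := pow_le_pow_left₀ (norm_nonneg _) hw.2.2 ij.2
      simp only [norm_neg, norm_mul, norm_pow, mul_assoc]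
      have := hw.1
      have hA0 : 0 ≤ A := (norm_nonneg _).trans this
      gcongr)
    (fun ij => (hdiff ij).continuous.continuousOn)
  have := (hprod.tendstoUniformlyOn.mono hVK).differentiableOn_of_isOpen hV fun B => by
    exact DifferentiableOn.finset_prod_of_normed B
      fun ij _ => ((hdiff ij).const_add 1).differentiableOn
  exact (this.differentiableAt (hV.mem_nhds hw)).differentiableWithinAt

theorem _root_.DifferentiableOn.pochOn {E : Type*} [NormedAddCommGroup E] [NormedSpace ℂ E]
    {a p q : E → ℂ} {s : Set E} (S : Set (ℕ × ℕ)) (ha : DifferentiableOn ℂ a s)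
    (hp : DifferentiableOn ℂ p s) (hq : DifferentiableOn ℂ q s) (hp1 : ∀ z ∈ s, ‖p z‖ < 1)
    (hq1 : ∀ z ∈ s, ‖q z‖ < 1) : DifferentiableOn ℂ (fun z => pochOn S (a z) (p z) (q z)) s :=
  DifferentiableOn.comp (f := fun z => (a z, p z, q z)) (differentiableOn_pochOn_uncurried S)
    (ha.prodMk (hp.prodMk hq)) fun z hz => ⟨hp1 z hz, hq1 z hz⟩

theorem _root_.ContinuousOn.pochOn {X : Type*} [TopologicalSpace X]
    {a p q : X → ℂ} {s : Set X} (S : Set (ℕ × ℕ)) (ha : ContinuousOn a s)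
    (hp : ContinuousOn p s) (hq : ContinuousOn q s) (hp1 : ∀ z ∈ s, ‖p z‖ < 1)
    (hq1 : ∀ z ∈ s, ‖q z‖ < 1) : ContinuousOn (fun z => pochOn S (a z) (p z) (q z)) s :=
  ContinuousOn.comp (f := fun z => (a z, p z, q z))
    (differentiableOn_pochOn_uncurried S).continuousOn
    (ha.prodMk (hp.prodMk hq)) fun z hz => ⟨hp1 z hz, hq1 z hz⟩

/-- `1 / (Γ(z; p, q) Γ(z⁻¹; p, q))` as a holomorphic function of `z ≠ 0`. -/
def thetaPair (z p q : ℂ) : ℂ :=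
  pochOn {ij | ij.1 = 0} z p q * pochOn {ij | ij.1 = 0} z⁻¹ p q *
    (pochOn {ij | 0 < ij.1 ∧ ij.2 = 0} z p q * pochOn {ij | 0 < ij.1 ∧ ij.2 = 0} z⁻¹ p q)

theorem pochOn_univ_split (z : ℂ) (hp : ‖p‖ < 1) (hq : ‖q‖ < 1) :
    pochOn univ z p q = pochOn {ij | ij.1 = 0} z p q * pochOn {ij | 0 < ij.1 ∧ ij.2 = 0} z p q *
      pochOn univ (p * q * z) p q := by
  rw [← pochOn_image_succ, pochOn_mul_pochOn _ _ hp hq, pochOn_mul_pochOn _ _ hp hq]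
  · congr 1
    ext ⟨i, j⟩
    simp
    omega
  · rw [disjoint_left]
    rintro ⟨i, j⟩ h
    simp at h ⊢
    omega
  · rw [disjoint_left]
    rintro ⟨i, j⟩ h
    simp at h ⊢
    omega

theorem norm_mul_pow_mul_pow_lt_one (ha : ‖a‖ < 1) (hp : ‖p‖ < 1) (hq : ‖q‖ < 1) (i j : ℕ) :
    ‖a * p ^ i * q ^ j‖ < 1 := by
  rw [norm_mul, norm_mul, norm_pow, norm_pow]
  have h1 := pow_le_one₀ (norm_nonneg p) hp.le (n := i)
  have h2 := pow_le_one₀ (norm_nonneg q) hq.le (n := j)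
  calc ‖a‖ * ‖p‖ ^ i * ‖q‖ ^ j ≤ ‖a‖ * 1 * 1 := by gcongr
    _ < 1 := by simpa

theorem pochOn_ne_zero_of_norm_lt_one (S : Set (ℕ × ℕ)) (ha : ‖a‖ < 1) (hp : ‖p‖ < 1)
    (hq : ‖q‖ < 1) : pochOn S a p q ≠ 0 := by
  rw [pochOn_ne_zero_iff hp hq]
  intro ij _ h
  have := norm_mul_pow_mul_pow_lt_one ha hp hq ij.1 ij.2
  rw [h] at this
  simp at this

/-- The numerators `(pq z^∓; p, q)` cancel the factors of `(z^±; p, q)` with both exponents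
positive, leaving those on the axes. Only the numerators must not vanish, which `|z| = 1` ensures.
At a pole of `Γ` the convention `1/0 = 0` gives the correct value `0`. -/
theorem inv_ellGamma_mul_ellGamma_inv {z : ℂ} (hz : ‖z‖ = 1) (hp : ‖p‖ < 1) (hq : ‖q‖ < 1) :
    (ellGamma z p q * ellGamma z⁻¹ p q)⁻¹ = thetaPair z p q := by
  have h1 : pochOn univ (p * q * z) p q ≠ 0 := by
    refine pochOn_ne_zero_of_norm_lt_one _ ?_ hp hq
    rw [norm_mul, norm_mul, hz, mul_one]
    exact mul_lt_one_of_nonneg_of_lt_one_left (norm_nonneg _) hp hq.le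
  have h2 : pochOn univ (p * q * z⁻¹) p q ≠ 0 := by
    refine pochOn_ne_zero_of_norm_lt_one _ ?_ hp hq
    rw [norm_mul, norm_mul, norm_inv, hz, inv_one, mul_one]
    exact mul_lt_one_of_nonneg_of_lt_one_left (norm_nonneg _) hp hq.le
  simp only [ellGamma, pochhammer_eq_pochOn_univ, inv_inv, mul_inv, inv_div, thetaPair]
  rw [pochOn_univ_split z hp hq, pochOn_univ_split z⁻¹ hp hq, div_mul_div_comm,
    div_eq_iff (mul_ne_zero h2 h1)]
  ring

end PartialProducts

end VanDiejen

/-! ### Iterated integrals over two circles. -/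

noncomputable section IteratedIntegrals

/-- The open annulus `{σ < |y| < σ⁻¹}`. -/
def openAnnulus (σ : ℝ) : Set ℂ := {y | σ < ‖y‖ ∧ ‖y‖ < σ⁻¹}

theorem isOpen_openAnnulus (σ : ℝ) : IsOpen (openAnnulus σ) :=
  (isOpen_lt continuous_const continuous_norm).inter (isOpen_lt continuous_norm continuous_const)

theorem sphere_subset_openAnnulus {σ r : ℝ} (h1 : σ < r) (h2 : r < σ⁻¹) :
    sphere (0 : ℂ) r ⊆ openAnnulus σ := fun y hy => by
  rw [mem_sphere_zero_iff_norm] at hy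
  exact ⟨hy ▸ h1, hy ▸ h2⟩

/-- The sum of the integrals of `f₁ g` over `|y| = r` and of `f₂ g` over `|y| = s`. -/
def splitIntegral (r s : ℝ) (f₁ f₂ g : ℂ → ℂ) : ℂ :=
  (∮ y in C(0, r), f₁ y * g y) + ∮ y in C(0, s), f₂ y * g y

/-- The `n`-fold iterate of `splitIntegral`. -/
def iterSplitIntegral (r s : ℝ) (f₁ f₂ : ℂ → ℂ) : ∀ n : ℕ, ((Fin n → ℂ) → ℂ) → ℂ
  | 0, H => H Fin.elim0
  | n + 1, H => splitIntegral r s f₁ f₂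
      fun y => iterSplitIntegral r s f₁ f₂ n fun w => H (Fin.cons y w)

theorem differentiable_fin_cons_prod {E : Type*} [NormedAddCommGroup E] [NormedSpace ℂ E] (n : ℕ) :
    Differentiable ℂ fun x : (Fin n → ℂ) × (ℂ × E) =>
      ((Fin.cons x.2.1 x.1 : Fin (n + 1) → ℂ), x.2.2) := by
  refine Differentiable.prodMk (differentiable_pi.2 fun i => ?_) (by fun_prop)
  refine Fin.cases ?_ (fun j => ?_) i
  · simp only [Fin.cons_zero]; fun_prop
  · simp only [Fin.cons_succ]; fun_prop

/-- Induction on `n` with the parameter space varying: the outermost integration variable joins the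
parameters, so that `E` becomes `ℂ × E` and `V` becomes `A × V`. The functions `f₁`, `f₂` may have
poles elsewhere in `A`; only their behaviour on the respective circles enters. -/
theorem differentiableOn_iterSplitIntegral {A : Set ℂ} (hA : IsOpen A) {r s : ℝ} (hr : 0 ≤ r)
    (hs : 0 ≤ s) (hrA : sphere (0 : ℂ) r ⊆ A) (hsA : sphere (0 : ℂ) s ⊆ A) (n : ℕ) :
    ∀ {E : Type*} [NormedAddCommGroup E] [NormedSpace ℂ E] [ProperSpace E] {V : Set E},
      IsOpen V → ∀ {f₁ f₂ : ℂ × E → ℂ} {H : (Fin n → ℂ) × E → ℂ},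
      DifferentiableOn ℂ f₁ (sphere 0 r ×ˢ V) → DifferentiableOn ℂ f₂ (sphere 0 s ×ˢ V) →
      DifferentiableOn ℂ H ({w | ∀ k, w k ∈ A} ×ˢ V) →
      DifferentiableOn ℂ (fun z => iterSplitIntegral r s (fun y => f₁ (y, z)) (fun y => f₂ (y, z)) n
        fun w => H (w, z)) V := by
  induction n with
  | zero =>
    intro E _ _ _ V hV f₁ f₂ H hf₁ hf₂ hH
    exact hH.comp (f := fun z : E => ((Fin.elim0 : Fin 0 → ℂ), z)) (by fun_prop)
      fun z hz => ⟨fun k => k.elim0, hz⟩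
  | succ n ih =>
    intro E _ _ _ V hV f₁ f₂ H hf₁ hf₂ hH
    have hin := ih (E := ℂ × E) (hA.prod hV) (f₁ := fun x => f₁ (x.1, x.2.2))
      (f₂ := fun x => f₂ (x.1, x.2.2)) (H := fun x => H (Fin.cons x.2.1 x.1, x.2.2))
      (hf₁.comp (by fun_prop) fun x hx => ⟨hx.1, hx.2.2⟩)
      (hf₂.comp (by fun_prop) fun x hx => ⟨hx.1, hx.2.2⟩)
      (hH.comp (differentiable_fin_cons_prod n).differentiableOn fun x hx =>
        ⟨fun k => Fin.cases (by simpa using hx.2.1) (fun j => by simpa using hx.1 j) k, hx.2.2⟩)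
    exact (differentiableOn_circleIntegral_param
        (hf₁.mul (hin.mono (prod_mono hrA Subset.rfl))) hV hr fun y hy z hz => ⟨hy, hz⟩).add
      (differentiableOn_circleIntegral_param
        (hf₂.mul (hin.mono (prod_mono hsA Subset.rfl))) hV hs fun y hy z hz => ⟨hy, hz⟩)

theorem circleIntegral_congr {f g : ℂ → ℂ} {r : ℝ} (hr : 0 ≤ r)
    (h : ∀ y ∈ sphere (0 : ℂ) r, f y = g y) : (∮ y in C(0, r), f y) = ∮ y in C(0, r), g y :=
  circleIntegral.integral_congr hr h

/-- The inner integral is holomorphic on `A` as a function of the outer variable, so it is an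
admissible test function `g` for the one-variable identity. The inductive hypothesis then applies to
every slice. -/
theorem iterSplitIntegral_congr {A : Set ℂ} (hA : IsOpen A) {r s r' s' : ℝ} (hr : 0 ≤ r)
    (hs : 0 ≤ s) (hr' : 0 ≤ r') (hs' : 0 ≤ s') (hrA : sphere (0 : ℂ) r ⊆ A)
    (hsA : sphere (0 : ℂ) s ⊆ A) (hrA' : sphere (0 : ℂ) r' ⊆ A) (hsA' : sphere (0 : ℂ) s' ⊆ A)
    {f₁ f₂ f₁' f₂' : ℂ → ℂ} (hf₁ : DifferentiableOn ℂ f₁ (sphere 0 r))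
    (hf₂ : DifferentiableOn ℂ f₂ (sphere 0 s))
    (h : ∀ g, DifferentiableOn ℂ g A →
      splitIntegral r s f₁ f₂ g = splitIntegral r' s' f₁' f₂' g) (n : ℕ) :
    ∀ {H : (Fin n → ℂ) → ℂ}, DifferentiableOn ℂ H {w | ∀ k, w k ∈ A} →
      iterSplitIntegral r s f₁ f₂ n H = iterSplitIntegral r' s' f₁' f₂' n H := by
  induction n with
  | zero => intro H _; rfl
  | succ n ih =>
    intro H hH
    have hH' : DifferentiableOn ℂ (fun x : (Fin n → ℂ) × ℂ => H (Fin.cons x.2 x.1))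
        ({w | ∀ k, w k ∈ A} ×ˢ A) := by
      refine hH.comp (f := fun x : (Fin n → ℂ) × ℂ => (Fin.cons x.2 x.1 : Fin (n + 1) → ℂ))
        (Differentiable.differentiableOn ?_) fun x hx => ?_
      · refine differentiable_pi.2 fun i => Fin.cases ?_ (fun j => ?_) i
        · simp only [Fin.cons_zero]; fun_prop
        · simp only [Fin.cons_succ]; fun_prop
      · exact fun k => Fin.cases (by simpa using hx.2) (fun j => by simpa using hx.1 j) k
    have hslice : ∀ y ∈ A, iterSplitIntegral r s f₁ f₂ n (fun w => H (Fin.cons y w)) =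
        iterSplitIntegral r' s' f₁' f₂' n (fun w => H (Fin.cons y w)) := fun y hy =>
      ih (hH'.comp (f := fun w : Fin n → ℂ => (w, y)) (by fun_prop) fun w hw => ⟨hw, hy⟩)
    have hg : DifferentiableOn ℂ
        (fun y => iterSplitIntegral r s f₁ f₂ n fun w => H (Fin.cons y w)) A :=
      differentiableOn_iterSplitIntegral hA hr hs hrA hsA n hA (f₁ := fun x => f₁ x.1)
        (f₂ := fun x => f₂ x.1) (hf₁.comp (by fun_prop) fun x hx => hx.1)
        (hf₂.comp (by fun_prop) fun x hx => hx.1) hH'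
    simp only [iterSplitIntegral]
    rw [h _ hg, splitIntegral, splitIntegral]
    congr 1
    · exact circleIntegral_congr hr' fun y hy => by rw [hslice y (hrA' hy)]
    · exact circleIntegral_congr hs' fun y hy => by rw [hslice y (hsA' hy)]

theorem continuous_torusMap {n : ℕ} (c : Fin n → ℂ) (R : Fin n → ℝ) :
    Continuous (torusMap c R) := by
  unfold torusMap; fun_prop

theorem norm_torusMap_one {n : ℕ} (θ : Fin n → ℝ) (k : Fin n) :
    ‖torusMap (0 : Fin n → ℂ) (fun _ => 1) θ k‖ = 1 := by
  simp [torusMap]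

theorem torusIntegrable_of_continuousOn {n : ℕ} {f : (Fin n → ℂ) → ℂ}
    (hf : ContinuousOn f {w | ∀ k, ‖w k‖ = 1}) :
    TorusIntegrable f (0 : Fin n → ℂ) (fun _ => (1 : ℝ)) :=
  (hf.comp_continuous (continuous_torusMap _ _) norm_torusMap_one).integrableOn_Icc

theorem torusIntegral_congr {n : ℕ} {f g : (Fin n → ℂ) → ℂ}
    (h : ∀ w, (∀ k, ‖w k‖ = 1) → f w = g w) :
    (∯ w in T((0 : Fin n → ℂ), fun _ => (1 : ℝ)), f w) =
      ∯ w in T((0 : Fin n → ℂ), fun _ => (1 : ℝ)), g w := by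
  simp only [torusIntegral, h _ (norm_torusMap_one _)]

/-- Fubini; the trivial splitting `f + 0` over unit circles brings the torus integral into the form
compared with the continuation. -/
theorem torusIntegral_prod_mul_eq_iterSplitIntegral {f : ℂ → ℂ}
    (hf : ContinuousOn f (sphere 0 1)) (n : ℕ) :
    ∀ {H : (Fin n → ℂ) → ℂ}, ContinuousOn H {w | ∀ k, ‖w k‖ = 1} →
      (∯ w in T((0 : Fin n → ℂ), fun _ => (1 : ℝ)), (∏ k, f (w k)) * H w) =
        iterSplitIntegral 1 1 f (fun _ => 0) n H := by
  induction n with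
  | zero =>
    intro H _
    rw [torusIntegral_dim0]
    simp only [Finset.univ_eq_empty, Finset.prod_empty, one_mul, iterSplitIntegral]
    congr 1
    exact Subsingleton.elim _ _
  | succ n ih =>
    intro H hH
    have hcont : ContinuousOn (fun w : Fin (n + 1) → ℂ => (∏ k, f (w k)) * H w)
        {w | ∀ k, ‖w k‖ = 1} := by
      refine ContinuousOn.mul (continuousOn_finsetProd _ fun k _ => ?_) hH
      exact hf.comp (by fun_prop) fun w hw => by simpa using hw k
    rw [torusIntegral_succ (torusIntegrable_of_continuousOn hcont)]
    have h0 : (∮ _ in C((0 : ℂ), 1), (0 : ℂ)) = 0 := by simp [circleIntegral]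
    simp only [iterSplitIntegral, splitIntegral, zero_mul, h0, add_zero]
    refine circleIntegral_congr zero_le_one fun y hy => ?_
    rw [← ih, ← torusIntegral_const_mul]
    · change torusIntegral _ 0 (fun _ => 1) = _
      refine torusIntegral_congr fun w hw => ?_
      simp [Fin.prod_univ_succ, mul_assoc]
    · refine hH.comp (f := fun w : Fin n → ℂ => (Fin.cons y w : Fin (n + 1) → ℂ))
        (by fun_prop) fun w hw k => ?_
      exact Fin.cases (by simpa using hy) (fun j => by simpa using hw j) k

end IteratedIntegrals

/-! ### Independence of the splitting in one variable. -/

section SplitIntegrals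

theorem circleIntegral_eq_of_differentiableOn_closed_annulus {f : ℂ → ℂ} {r s : ℝ} (hr : 0 < r)
    (hrs : r ≤ s) (hf : DifferentiableOn ℂ f {y | r ≤ ‖y‖ ∧ ‖y‖ ≤ s}) :
    (∮ y in C(0, r), f y) = ∮ y in C(0, s), f y := by
  refine (Complex.circleIntegral_eq_of_differentiable_on_annulus_off_countable hr hrs
    countable_empty (hf.continuousOn.mono fun y hy => ?_) fun y hy => ?_).symm
  · simpa [and_comm] using hy
  · have hy' : r < ‖y‖ ∧ ‖y‖ < s := by simpa [and_comm] using hy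
    refine hf.differentiableAt (mem_of_superset (IsOpen.mem_nhds (s := {y : ℂ | r < ‖y‖ ∧ ‖y‖ < s})
      ?_ hy') fun w hw => ⟨hw.1.le, hw.2.le⟩)
    exact (isOpen_lt continuous_const continuous_norm).inter
      (isOpen_lt continuous_norm continuous_const)

variable {σ R : ℝ} {f₁ f₂ f₁' f₂' W : ℂ → ℂ} {Out Inn : Set ℂ}

/-- The difference `d = f₁ - f₁' = f₂' - f₂` is holomorphic off `Out` by its first form and off
`Inn` by its second. As the two sets are disjoint, `d` is holomorphic on the whole annulus, and
Cauchy's theorem equates its integrals against `g` over `|y| = R` and `|y| = R⁻¹`. -/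
theorem splitIntegral_eq_splitIntegral (hR : 0 < R) (hR1 : R ≤ 1) (hσ : 0 < σ) (hσR : σ < R)
    (hOut : IsOpen (openAnnulus σ \ Out)) (hInn : IsOpen (openAnnulus σ \ Inn))
    (hdisj : Disjoint Out Inn) (hOutR : ∀ y ∈ Out, R < ‖y‖) (hInnR : ∀ y ∈ Inn, ‖y‖ < R⁻¹)
    (hf₁ : DifferentiableOn ℂ f₁ (openAnnulus σ \ Out))
    (hf₂ : DifferentiableOn ℂ f₂ (openAnnulus σ \ Inn))
    (hf₁' : DifferentiableOn ℂ f₁' (openAnnulus σ \ Out))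
    (hf₂' : DifferentiableOn ℂ f₂' (openAnnulus σ \ Inn))
    (h : ∀ y ∈ openAnnulus σ, y ∉ Out → y ∉ Inn → f₁ y + f₂ y = f₁' y + f₂' y)
    (g : ℂ → ℂ) (hg : DifferentiableOn ℂ g (openAnnulus σ)) :
    splitIntegral R R⁻¹ f₁ f₂ g = splitIntegral R R⁻¹ f₁' f₂' g := by
  classical
  have hRR : R ≤ R⁻¹ := hR1.trans ((one_le_inv₀ hR).2 hR1)
  have hσR' : R⁻¹ < σ⁻¹ := inv_strictAnti₀ hσ hσR
  have hsR := sphere_subset_openAnnulus hσR (hRR.trans_lt hσR')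
  have hsR' := sphere_subset_openAnnulus (hσR.trans_le hRR) hσR'
  let d : ℂ → ℂ := fun y => if y ∈ Out then f₂' y - f₂ y else f₁ y - f₁' y
  have hd1 : ∀ y, y ∉ Out → d y = f₁ y - f₁' y := fun y hy => if_neg hy
  have hd2 : ∀ y ∈ openAnnulus σ, y ∉ Inn → d y = f₂' y - f₂ y := fun y hyA hy => by
    by_cases ho : y ∈ Out
    · exact if_pos ho
    · rw [hd1 y ho]
      linear_combination h y hyA ho hy
  have hd : DifferentiableOn ℂ d (openAnnulus σ) := by
    intro y hy
    by_cases ho : y ∈ Out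
    · have hi : y ∉ Inn := disjoint_left.1 hdisj ho
      have := ((hf₂'.sub hf₂).congr fun w hw => hd2 w hw.1 hw.2)
      exact (this.differentiableAt (hInn.mem_nhds ⟨hy, hi⟩)).differentiableWithinAt
    · have := ((hf₁.sub hf₁').congr fun w hw => hd1 w hw.2)
      exact (this.differentiableAt (hOut.mem_nhds ⟨hy, ho⟩)).differentiableWithinAt
  have hnO : ∀ y ∈ sphere (0 : ℂ) R, y ∉ Out := fun y hy ho => by
    rw [mem_sphere_zero_iff_norm] at hy
    exact (hOutR y ho).ne' hy
  have hnI : ∀ y ∈ sphere (0 : ℂ) R⁻¹, y ∉ Inn := fun y hy ho => by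
    rw [mem_sphere_zero_iff_norm] at hy
    exact (hInnR y ho).ne hy
  have hdg := circleIntegral_eq_of_differentiableOn_closed_annulus hR hRR
    ((hd.mul hg).mono fun y hy => ⟨hσR.trans_le hy.1, hy.2.trans_lt hσR'⟩)
  have hint : ∀ {f : ℂ → ℂ} {r : ℝ} (B : Set ℂ), 0 ≤ r → sphere (0 : ℂ) r ⊆ openAnnulus σ →
      (∀ y ∈ sphere (0 : ℂ) r, y ∉ B) → DifferentiableOn ℂ f (openAnnulus σ \ B) →
      CircleIntegrable (fun y => f y * g y) 0 r := fun B hr hs hB hf =>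
    ContinuousOn.circleIntegrable hr
      ((hf.continuousOn.mono fun y hy => ⟨hs hy, hB y hy⟩).mul (hg.continuousOn.mono hs))
  have e1 : (∮ y in C(0, R), d y * g y) =
      (∮ y in C(0, R), f₁ y * g y) - ∮ y in C(0, R), f₁' y * g y := by
    rw [← circleIntegral.integral_sub (hint Out hR.le hsR hnO hf₁) (hint Out hR.le hsR hnO hf₁')]
    exact circleIntegral_congr hR.le fun y hy => by rw [hd1 y (hnO y hy)]; ring
  have e2 : (∮ y in C(0, R⁻¹), d y * g y) =
      (∮ y in C(0, R⁻¹), f₂' y * g y) - ∮ y in C(0, R⁻¹), f₂ y * g y := by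
    have hR' : 0 ≤ R⁻¹ := inv_nonneg.2 hR.le
    rw [← circleIntegral.integral_sub (hint Inn hR' hsR' hnI hf₂') (hint Inn hR' hsR' hnI hf₂)]
    exact circleIntegral_congr hR' fun y hy => by rw [hd2 y (hsR' hy) (hnI y hy)]; ring
  simp only [Pi.mul_apply] at hdg
  rw [e1, e2] at hdg
  rw [splitIntegral, splitIntegral]
  linear_combination hdg

/-- When the unit circle separates the poles, `f₁` has none in `R ≤ |y| ≤ 1` and `f₂` none in `1 ≤
|y| ≤ R⁻¹`, so both contours move to `|y| = 1` and the integrands add up. -/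
theorem splitIntegral_eq_circleIntegral (hR : 0 < R) (hR1 : R ≤ 1) (hσ : 0 < σ) (hσR : σ < R)
    (hOut1 : ∀ y ∈ Out, 1 < ‖y‖) (hInn1 : ∀ y ∈ Inn, ‖y‖ < 1)
    (hf₁ : DifferentiableOn ℂ f₁ (openAnnulus σ \ Out))
    (hf₂ : DifferentiableOn ℂ f₂ (openAnnulus σ \ Inn))
    (h : ∀ y, ‖y‖ = 1 → f₁ y + f₂ y = W y)
    (g : ℂ → ℂ) (hg : DifferentiableOn ℂ g (openAnnulus σ)) :
    splitIntegral R R⁻¹ f₁ f₂ g = splitIntegral 1 1 W (fun _ => 0) g := by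
  have hRR : 1 ≤ R⁻¹ := (one_le_inv₀ hR).2 hR1
  have hσR' : R⁻¹ < σ⁻¹ := inv_strictAnti₀ hσ hσR
  have hg1 : DifferentiableOn ℂ (fun y => f₁ y * g y) {y | R ≤ ‖y‖ ∧ ‖y‖ ≤ 1} :=
    (hf₁.mul (hg.mono sdiff_subset)).mono fun y hy =>
      ⟨⟨hσR.trans_le hy.1, hy.2.trans_lt (hRR.trans_lt hσR')⟩, fun ho => (hOut1 y ho).not_ge hy.2⟩
  have hg2 : DifferentiableOn ℂ (fun y => f₂ y * g y) {y | 1 ≤ ‖y‖ ∧ ‖y‖ ≤ R⁻¹} :=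
    (hf₂.mul (hg.mono sdiff_subset)).mono fun y hy =>
      ⟨⟨(hσR.trans_le hR1).trans_le hy.1, hy.2.trans_lt hσR'⟩, fun ho => (hInn1 y ho).not_ge hy.1⟩
  have h0 : (∮ y in C((0 : ℂ), 1), (0 : ℂ) * g y) = 0 := by simp [circleIntegral]
  rw [splitIntegral, splitIntegral, h0, add_zero,
    circleIntegral_eq_of_differentiableOn_closed_annulus hR hR1 hg1,
    ← circleIntegral_eq_of_differentiableOn_closed_annulus one_pos hRR hg2,
    ← circleIntegral.integral_add]
  · refine circleIntegral_congr zero_le_one fun y hy => ?_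
    rw [← h y (by simpa using hy)]
    ring
  · refine ContinuousOn.circleIntegrable zero_le_one (hg1.continuousOn.mono fun y hy => ?_)
    rw [mem_sphere_zero_iff_norm] at hy
    exact ⟨hy ▸ hR1, hy.le⟩
  · refine ContinuousOn.circleIntegrable zero_le_one (hg2.continuousOn.mono fun y hy => ?_)
    rw [mem_sphere_zero_iff_norm] at hy
    exact ⟨hy.ge, hy ▸ hRR⟩

end SplitIntegrals

namespace VanDiejen

/-! ### The domain in terms of the parameters `c_j`. -/

noncomputable section Regions

variable {m : ℕ}

/-- Indices of the parameters of the weight as a function of a single variable: the dual parameters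
`b_s`, and `(p q / t)^{1/2} x_i^{±1}`. -/
abbrev ParamIdx (m : ℕ) : Type := Fin 8 ⊕ (Fin m × ℤˣ)

/-- The parameters `c` such that the integrand has factors `Γ(c y^±; p, q)` in each variable `y`. -/
def kernelParam (z : Vars m) : ParamIdx m → ℂ
  | .inl s => dualParams z.2.1 z.2.2.1 z.2.2.2.1 z.2.2.2.2 s
  | .inr (i, ε) => z.2.2.1 * z.2.2.2.1 * (z.2.2.2.2)⁻¹ * z.1 i ^ (ε : ℤ)

/-- The base `p`. -/
def baseP (z : Vars m) : ℂ := z.2.2.1 ^ 2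

/-- The base `q`. -/
def baseQ (z : Vars m) : ℂ := z.2.2.2.1 ^ 2

/-- The parameter `t`. -/
def baseT (z : Vars m) : ℂ := z.2.2.2.2 ^ 2

/-- Pairs of parameters whose product is constrained in the continuation domain. -/
def ConstrainedPair : ParamIdx m → ParamIdx m → Prop
  | .inr (i, _), .inr (j, _) => i ≠ j
  | _, _ => True

/-- The variables for which all factors of the integrand are meaningful. -/
def baseRegion (m : ℕ) : Set (Vars m) :=
  {z | z.2.2.1 ≠ 0 ∧ z.2.2.2.1 ≠ 0 ∧ z.2.2.2.2 ≠ 0 ∧ (∀ s, z.2.1 s ≠ 0) ∧ (∀ i, z.1 i ≠ 0) ∧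
    ‖baseP z‖ < 1 ∧ ‖baseQ z‖ < 1}

theorem forall_ne_pos_zpow_iff {p q X Y : ℂ} (hp : p ≠ 0) (hq : q ≠ 0) (hX : X ≠ 0) :
    (∀ μ ν : ℤ, 0 < μ → 0 < ν → X ≠ p ^ μ * q ^ ν * Y) ↔
      ∀ ij ∈ (univ : Set (ℕ × ℕ)), (p * q * Y * X⁻¹) * p ^ ij.1 * q ^ ij.2 ≠ 1 := by
  constructor
  · rintro h ⟨i, j⟩ - he
    refine h (i + 1) (j + 1) (by positivity) (by positivity) ?_
    have h1 : p ^ ((i : ℤ) + 1) = p ^ i * p := by rw [zpow_add_one₀ hp, zpow_natCast]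
    have h2 : q ^ ((j : ℤ) + 1) = q ^ j * q := by rw [zpow_add_one₀ hq, zpow_natCast]
    rw [h1, h2]
    field_simp at he
    linear_combination -he
  · intro h μ ν hμ hν he
    obtain ⟨i, rfl⟩ : ∃ i : ℕ, μ = i + 1 := ⟨(μ - 1).toNat, by omega⟩
    obtain ⟨j, rfl⟩ : ∃ j : ℕ, ν = j + 1 := ⟨(ν - 1).toNat, by omega⟩
    refine h (i, j) (mem_univ _) ?_
    rw [zpow_add_one₀ hp, zpow_natCast, zpow_add_one₀ hq, zpow_natCast] at he
    field_simp
    linear_combination -he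

/-- Substitute `μ = -(i + d + 1)`, `ν = -(j + d + 1)`. The case `d = 0` serves the products of two
different parameters, and `d = 1` the weaker condition on `x_i²`. -/
theorem forall_ne_neg_zpow_iff {p q X Y : ℂ} (hp : p ≠ 0) (hq : q ≠ 0) (hY : Y ≠ 0) (d : ℕ) :
    (∀ μ ν : ℤ, μ < -d → ν < -d → X ≠ p ^ μ * q ^ ν * Y) ↔
      ∀ ij ∈ (univ : Set (ℕ × ℕ)),
        (p * q * X * Y⁻¹ * (p * q) ^ d) * p ^ ij.1 * q ^ ij.2 ≠ 1 := by
  have key : ∀ i j : ℕ, X = p ^ (-((i : ℤ) + d + 1)) * q ^ (-((j : ℤ) + d + 1)) * Y ↔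
      (p * q * X * Y⁻¹ * (p * q) ^ d) * p ^ i * q ^ j = 1 := by
    intro i j
    have h1 : p ^ (-((i : ℤ) + d + 1)) = (p ^ (i + d + 1))⁻¹ := by
      rw [zpow_neg]; norm_cast
    have h2 : q ^ (-((j : ℤ) + d + 1)) = (q ^ (j + d + 1))⁻¹ := by
      rw [zpow_neg]; norm_cast
    have hp' : p ^ (i + d + 1) ≠ 0 := pow_ne_zero _ hp
    have hq' : q ^ (j + d + 1) ≠ 0 := pow_ne_zero _ hq
    have h3 : (p * q * X * Y⁻¹ * (p * q) ^ d) * p ^ i * q ^ j =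
        X * (p ^ (i + d + 1) * q ^ (j + d + 1)) * Y⁻¹ := by ring
    rw [h1, h2, h3, ← mul_inv, inv_mul_eq_div, eq_div_iff (mul_ne_zero hp' hq'),
      mul_inv_eq_one₀ hY]
  constructor
  · rintro h ⟨i, j⟩ - he
    exact h _ _ (by omega) (by omega) ((key i j).2 he)
  · intro h μ ν hμ hν he
    obtain ⟨i, rfl⟩ : ∃ i : ℕ, μ = -((i : ℤ) + d + 1) := ⟨(-μ - d - 1).toNat, by omega⟩
    obtain ⟨j, rfl⟩ : ∃ j : ℕ, ν = -((j : ℤ) + d + 1) := ⟨(-ν - d - 1).toNat, by omega⟩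
    exact h (i, j) (mem_univ _) ((key i j).1 he)

theorem kernelParam_ne_zero {z : Vars m} (hz : z ∈ baseRegion m) (j : ParamIdx m) :
    kernelParam z j ≠ 0 := by
  obtain ⟨hu, hv, hτ, ha, hx, -, -⟩ := hz
  rcases j with s | ⟨i, ε⟩
  · exact mul_ne_zero (mul_ne_zero (mul_ne_zero hu hv) hτ) (inv_ne_zero (ha s))
  · exact mul_ne_zero (mul_ne_zero (mul_ne_zero hu hv) (inv_ne_zero hτ)) (zpow_ne_zero _ (hx i))

/-- The products of the `c_j` are `pqt/(a_r a_s)`, `pq x_i^ε/a_s` and `pq x_i^ε x_j^ε'/t`, so the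
excluded lattices say exactly that `(c_j c_k; p, q)_∞ ≠ 0`. For `x_i^{2ε}` an extra factor `pq`
remains: only relations with both exponents positive are forbidden. In this form openness and the
possible pinchings can be read off. -/
theorem mem_continuationDomain_iff {R : ℝ} (hR : 0 < R) {z : Vars m} :
    z ∈ continuationDomain m R ↔ z ∈ baseRegion m ∧ ‖baseT z‖ < R ^ 2 ∧
      ‖baseP z‖ < ‖(baseQ z)⁻¹ * baseT z‖ * (R ^ 2)⁻¹ ∧
      (∀ j, ‖kernelParam z j‖ * R < 1) ∧
      pochOn univ (baseP z * baseQ z * (baseT z)⁻¹) (baseP z) (baseQ z) ≠ 0 ∧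
      (∀ j k, ConstrainedPair j k →
        pochOn univ (kernelParam z j * kernelParam z k) (baseP z) (baseQ z) ≠ 0) ∧
      ∀ i, pochOn univ (kernelParam z (.inr i) ^ 2 * (baseP z * baseQ z)) (baseP z) (baseQ z) ≠ 0 := by
  obtain ⟨x, a, u, v, τ⟩ := z
  by_cases hbase : (x, a, u, v, τ) ∈ baseRegion m
  swap
  · refine iff_of_false (fun h => hbase ?_) fun h => hbase h.1
    obtain ⟨⟨⟨h1, h2, h3, h4, h5⟩, h6, h7, h8, h9⟩, h10, h11⟩ := h
    exact ⟨by simpa using h1, by simpa using h2, by simpa using h3, fun s => (h7 s).1,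
      fun i => (h10 i).1, h6.trans_le (min_le_left _ _), h4⟩
  obtain ⟨hu, hv, hτ, ha, hx, hp, hq⟩ := id hbase
  simp only [baseP, baseQ] at hu hv hτ ha hx hp hq
  have hc := kernelParam_ne_zero hbase
  have hp0 : u ^ 2 ≠ 0 := pow_ne_zero _ hu
  have hq0 : v ^ 2 ≠ 0 := pow_ne_zero _ hv
  have ht0 : τ ^ 2 ≠ 0 := pow_ne_zero _ hτ
  have hcl : ∀ s, kernelParam (x, a, u, v, τ) (.inl s) = u * v * τ * (a s)⁻¹ := fun s => rfl
  have hcr : ∀ i (ε : ℤˣ), kernelParam (x, a, u, v, τ) (.inr (i, ε)) =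
      u * v * τ⁻¹ * x i ^ (ε : ℤ) := fun i ε => rfl
  have hA : (∀ s, a s ≠ 0 ∧ ‖u * v * τ‖ * R < ‖a s‖) ↔
      ∀ s, ‖kernelParam (x, a, u, v, τ) (.inl s)‖ * R < 1 := by
    refine forall_congr' fun s => ?_
    have := norm_pos_iff.2 (ha s)
    rw [hcl, norm_mul _ (a s)⁻¹, norm_inv, mul_right_comm ‖u * v * τ‖,
      ← div_eq_mul_inv, div_lt_one this]
    exact and_iff_right (ha s)
  have hX : (∀ i, x i ≠ 0 ∧ ‖u * v * τ⁻¹‖ * R < ‖x i‖ ∧ ‖x i‖ < ‖(u * v * τ⁻¹)⁻¹‖ * R⁻¹) ↔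
      ∀ i : Fin m × ℤˣ, ‖kernelParam (x, a, u, v, τ) (.inr i)‖ * R < 1 := by
    rw [Prod.forall]
    refine forall_congr' fun i => ?_
    have hxi := norm_pos_iff.2 (hx i)
    have hs : 0 < ‖u * v * τ⁻¹‖ := norm_pos_iff.2 (mul_ne_zero (mul_ne_zero hu hv) (inv_ne_zero hτ))
    have h1 : ‖u * v * τ⁻¹ * x i‖ * R < 1 ↔ ‖x i‖ < ‖(u * v * τ⁻¹)⁻¹‖ * R⁻¹ := by
      rw [norm_mul _ (x i), norm_inv (u * v * τ⁻¹), ← mul_inv, lt_inv_comm₀ hxi (mul_pos hs hR),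
        mul_right_comm, ← lt_div_iff₀ hxi, one_div]
    have h2 : ‖u * v * τ⁻¹ * (x i)⁻¹‖ * R < 1 ↔ ‖u * v * τ⁻¹‖ * R < ‖x i‖ := by
      rw [norm_mul _ (x i)⁻¹, norm_inv (x i),
        mul_right_comm ‖u * v * τ⁻¹‖, ← div_eq_mul_inv, div_lt_one hxi]
    rw [← h1, ← h2]
    constructor
    · rintro ⟨-, h3, h4⟩ ε
      rcases Int.units_eq_one_or ε with rfl | rfl
      · simpa [hcr] using h4
      · simpa [hcr] using h3
    · intro h
      exact ⟨hx i, by simpa [hcr] using h (-1), by simpa [hcr] using h 1⟩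
  have hB : (∀ μ ν : ℤ, 0 < μ → 0 < ν → τ ^ 2 ≠ (u ^ 2) ^ μ * (v ^ 2) ^ ν) ↔
      pochOn univ (u ^ 2 * v ^ 2 * (τ ^ 2)⁻¹) (u ^ 2) (v ^ 2) ≠ 0 := by
    have := forall_ne_pos_zpow_iff hp0 hq0 ht0 (Y := 1)
    rw [pochOn_ne_zero_iff hp hq]
    simpa only [mul_one] using this
  have hC : ∀ r s, (∀ μ ν : ℤ, 0 < μ → 0 < ν → a r * a s ≠ (u ^ 2) ^ μ * (v ^ 2) ^ ν * τ ^ 2) ↔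
      pochOn univ (kernelParam (x, a, u, v, τ) (.inl r) * kernelParam (x, a, u, v, τ) (.inl s))
        (u ^ 2) (v ^ 2) ≠ 0 := by
    intro r s
    rw [forall_ne_pos_zpow_iff hp0 hq0 (mul_ne_zero (ha r) (ha s)), pochOn_ne_zero_iff hp hq, hcl,
      hcl]
    have : u ^ 2 * v ^ 2 * τ ^ 2 * (a r * a s)⁻¹ =
      u * v * τ * (a r)⁻¹ * (u * v * τ * (a s)⁻¹) := by rw [mul_inv]; ring
    rw [this]
  have hD : ∀ s i (ε : ℤˣ), (∀ μ ν : ℤ, μ < 0 → ν < 0 →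
      x i ^ (ε : ℤ) ≠ a s * (u ^ 2) ^ μ * (v ^ 2) ^ ν) ↔
      pochOn univ (kernelParam (x, a, u, v, τ) (.inr (i, ε)) *
        kernelParam (x, a, u, v, τ) (.inl s)) (u ^ 2) (v ^ 2) ≠ 0 := by
    intro s i ε
    have h := forall_ne_neg_zpow_iff hp0 hq0 (ha s) 0 (X := x i ^ (ε : ℤ))
    simp only [Nat.cast_zero, neg_zero, pow_zero, mul_one] at h
    have he : u ^ 2 * v ^ 2 * x i ^ (ε : ℤ) * (a s)⁻¹ =
        u * v * τ⁻¹ * x i ^ (ε : ℤ) * (u * v * τ * (a s)⁻¹) := by field_simp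
    rw [pochOn_ne_zero_iff hp hq, hcl, hcr, ← he, ← h]
    simp only [mul_assoc, mul_comm, mul_left_comm (a s)]
  have hE : ∀ i j (ε ε' : ℤˣ), (∀ μ ν : ℤ, μ < 0 → ν < 0 →
      x i ^ (ε : ℤ) * x j ^ (ε' : ℤ) ≠ (u ^ 2) ^ μ * (v ^ 2) ^ ν * τ ^ 2) ↔
      pochOn univ (kernelParam (x, a, u, v, τ) (.inr (i, ε)) *
        kernelParam (x, a, u, v, τ) (.inr (j, ε'))) (u ^ 2) (v ^ 2) ≠ 0 := by
    intro i j ε ε'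
    have h := forall_ne_neg_zpow_iff hp0 hq0 ht0 0 (X := x i ^ (ε : ℤ) * x j ^ (ε' : ℤ))
    simp only [Nat.cast_zero, neg_zero, pow_zero, mul_one] at h
    have he : u ^ 2 * v ^ 2 * (x i ^ (ε : ℤ) * x j ^ (ε' : ℤ)) * (τ ^ 2)⁻¹ =
        u * v * τ⁻¹ * x i ^ (ε : ℤ) * (u * v * τ⁻¹ * x j ^ (ε' : ℤ)) := by
      rw [← inv_pow]; ring
    rw [pochOn_ne_zero_iff hp hq, hcr, hcr, ← he, ← h]
  have hF : ∀ i (ε : ℤˣ), (∀ μ ν : ℤ, μ < -1 → ν < -1 →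
      (x i ^ (ε : ℤ)) ^ 2 ≠ (u ^ 2) ^ μ * (v ^ 2) ^ ν * τ ^ 2) ↔
      pochOn univ (kernelParam (x, a, u, v, τ) (.inr (i, ε)) ^ 2 * (u ^ 2 * v ^ 2))
        (u ^ 2) (v ^ 2) ≠ 0 := by
    intro i ε
    have h := forall_ne_neg_zpow_iff hp0 hq0 ht0 1 (X := (x i ^ (ε : ℤ)) ^ 2)
    simp only [Nat.cast_one, pow_one] at h
    have he : u ^ 2 * v ^ 2 * (x i ^ (ε : ℤ)) ^ 2 * (τ ^ 2)⁻¹ * (u ^ 2 * v ^ 2) =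
        (u * v * τ⁻¹ * x i ^ (ε : ℤ)) ^ 2 * (u ^ 2 * v ^ 2) := by
      rw [← inv_pow]; ring
    rw [pochOn_ne_zero_iff hp hq, hcr, ← he, ← h]
  have hG : (∀ j k, ConstrainedPair j k →
      pochOn univ (kernelParam (x, a, u, v, τ) j * kernelParam (x, a, u, v, τ) k)
        (u ^ 2) (v ^ 2) ≠ 0) ↔
      (∀ r s, pochOn univ (kernelParam (x, a, u, v, τ) (.inl r) *
        kernelParam (x, a, u, v, τ) (.inl s)) (u ^ 2) (v ^ 2) ≠ 0) ∧
      (∀ s i (ε : ℤˣ), pochOn univ (kernelParam (x, a, u, v, τ) (.inr (i, ε)) *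
        kernelParam (x, a, u, v, τ) (.inl s)) (u ^ 2) (v ^ 2) ≠ 0) ∧
      ∀ i j, i < j → ∀ (ε ε' : ℤˣ), pochOn univ (kernelParam (x, a, u, v, τ) (.inr (i, ε)) *
        kernelParam (x, a, u, v, τ) (.inr (j, ε'))) (u ^ 2) (v ^ 2) ≠ 0 := by
    constructor
    · intro h
      exact ⟨fun r s => h _ _ trivial, fun s i ε => h _ _ trivial,
        fun i j hij ε ε' => h _ _ hij.ne⟩
    · rintro ⟨h1, h2, h3⟩ (r | ⟨i, ε⟩) (s | ⟨j, ε'⟩) hjk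
      · exact h1 r s
      · rw [mul_comm]; exact h2 r j ε'
      · exact h2 s i ε
      · rcases lt_or_gt_of_ne hjk with hij | hij
        · exact h3 i j hij ε ε'
        · rw [mul_comm]; exact h3 j i hij ε' ε
  constructor
  · rintro ⟨⟨⟨-, -, -, -, h5⟩, h6, h7, h8, h9⟩, h10, h11, h12, h13⟩
    refine ⟨hbase, h5, (lt_min_iff.1 h6).2, ?_, hB.1 h8, hG.2 ⟨fun r s => (hC r s).1 (h9 r s),
      fun s i ε => (hD s i ε).1 (h11 s i ε), fun i j hij ε ε' => (hE i j ε ε').1 (h12 i j hij ε ε')⟩,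
      fun i => (hF i.1 i.2).1 (h13 i.1 i.2)⟩
    rintro (s | i)
    · exact hA.1 h7 s
    · exact hX.1 h10 i
  · rintro ⟨-, h5, h6, h7, h8, h9, h13⟩
    obtain ⟨h9, h11, h12⟩ := hG.1 h9
    exact ⟨⟨⟨hp0, hq0, ht0, hq, h5⟩, lt_min hp h6, hA.2 fun s => h7 (.inl s), hB.2 h8,
      fun r s => (hC r s).2 (h9 r s)⟩, hX.2 fun i => h7 (.inr i),
      fun s i ε => (hD s i ε).2 (h11 s i ε),
      fun i j hij ε ε' => (hE i j ε ε').2 (h12 i j hij ε ε'), fun i ε => (hF i ε).2 (h13 (i, ε))⟩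

end Regions

end VanDiejen

namespace VanDiejen

/-! ### Openness of the domain and density of the unpinched parameters. -/

noncomputable section RegionTopology

variable {m : ℕ}

theorem isOpen_baseRegion (m : ℕ) : IsOpen (baseRegion m) := by
  have h1 : IsOpen {z : Vars m | ∀ s, z.2.1 s ≠ 0} := by
    simp only [ofPred_forall]
    exact isOpen_iInter_of_finite fun s => isOpen_ne_fun (by fun_prop) continuous_const
  have h2 : IsOpen {z : Vars m | ∀ i, z.1 i ≠ 0} := by
    simp only [ofPred_forall]
    exact isOpen_iInter_of_finite fun s => isOpen_ne_fun (by fun_prop) continuous_const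
  have h3 : IsOpen {z : Vars m | ‖baseP z‖ < 1} :=
    isOpen_lt (by unfold baseP; fun_prop) continuous_const
  have h4 : IsOpen {z : Vars m | ‖baseQ z‖ < 1} :=
    isOpen_lt (by unfold baseQ; fun_prop) continuous_const
  exact (isOpen_ne_fun (by fun_prop) continuous_const).inter
    ((isOpen_ne_fun (by fun_prop) continuous_const).inter
      ((isOpen_ne_fun (by fun_prop) continuous_const).inter (h1.inter (h2.inter (h3.inter h4)))))

theorem differentiable_baseP : Differentiable ℂ (baseP : Vars m → ℂ) := by
  unfold baseP; fun_prop

theorem differentiable_baseQ : Differentiable ℂ (baseQ : Vars m → ℂ) := by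
  unfold baseQ; fun_prop

theorem differentiable_baseT : Differentiable ℂ (baseT : Vars m → ℂ) := by
  unfold baseT; fun_prop

theorem differentiableOn_kernelParam (j : ParamIdx m) :
    DifferentiableOn ℂ (fun z : Vars m => kernelParam z j) (baseRegion m) := by
  intro z hz
  obtain ⟨hu, hv, hτ, ha, hx, -, -⟩ := hz
  refine DifferentiableAt.differentiableWithinAt ?_
  rcases j with s | ⟨i, ε⟩
  · have h : DifferentiableAt ℂ (fun z : Vars m => (z.2.1 s)⁻¹) z :=
      DifferentiableAt.fun_inv (by fun_prop) (ha s)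
    exact DifferentiableAt.mul (by fun_prop) h
  · have h : DifferentiableAt ℂ (fun z : Vars m => (z.2.2.2.2)⁻¹) z :=
      DifferentiableAt.fun_inv (by fun_prop) hτ
    have h' : DifferentiableAt ℂ (fun z : Vars m => z.1 i ^ (ε : ℤ)) z := by
      rcases Int.units_eq_one_or ε with rfl | rfl
      · simp only [Units.val_one, zpow_one]; fun_prop
      · simp only [Units.val_neg, Units.val_one, zpow_neg, zpow_one]
        exact DifferentiableAt.fun_inv (by fun_prop) (hx i)
    exact DifferentiableAt.mul (DifferentiableAt.mul (by fun_prop) h) h'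

theorem eventually_pochOn_ne_zero {X : Type*} [TopologicalSpace X] {a p q : X → ℂ} {x : X}
    (S : Set (ℕ × ℕ)) (ha : ContinuousAt a x) (hp : ContinuousAt p x) (hq : ContinuousAt q x)
    (hp1 : ‖p x‖ < 1) (hq1 : ‖q x‖ < 1) (h : pochOn S (a x) (p x) (q x) ≠ 0) :
    ∀ᶠ y in 𝓝 x, pochOn S (a y) (p y) (q y) ≠ 0 := by
  have hop : IsOpen {w : ℂ × ℂ × ℂ | ‖w.2.1‖ < 1 ∧ ‖w.2.2‖ < 1} :=
    (isOpen_lt (f := fun w : ℂ × ℂ × ℂ => ‖w.2.1‖) (by fun_prop) continuous_const).inter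
      (isOpen_lt (f := fun w : ℂ × ℂ × ℂ => ‖w.2.2‖) (by fun_prop) continuous_const)
  have h1 : ContinuousAt (fun w : ℂ × ℂ × ℂ => pochOn S w.1 w.2.1 w.2.2) (a x, p x, q x) :=
    (differentiableOn_pochOn_uncurried S).continuousOn.continuousAt (hop.mem_nhds ⟨hp1, hq1⟩)
  have h2 : ContinuousAt (fun y => pochOn S (a y) (p y) (q y)) x :=
    ContinuousAt.comp (f := fun y => (a y, p y, q y)) h1 (ha.prodMk (hp.prodMk hq))
  exact h2.eventually_ne h

theorem isOpen_continuationDomain {R : ℝ} (hR : 0 < R) : IsOpen (continuationDomain m R) := by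
  rw [isOpen_iff_eventually]
  intro z hz
  rw [mem_continuationDomain_iff hR] at hz
  obtain ⟨hb, h1, h2, h3, h4, h5, h6⟩ := hz
  have hbn := (isOpen_baseRegion m).mem_nhds hb
  have hp := (differentiable_baseP (m := m)).continuous.continuousAt (x := z)
  have hq := (differentiable_baseQ (m := m)).continuous.continuousAt (x := z)
  have ht := (differentiable_baseT (m := m)).continuous.continuousAt (x := z)
  have hq0 : baseQ z ≠ 0 := pow_ne_zero _ hb.2.1
  have ht0 : baseT z ≠ 0 := pow_ne_zero _ hb.2.2.1
  have hc : ∀ j, ContinuousAt (fun z : Vars m => kernelParam z j) z := fun j =>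
    (differentiableOn_kernelParam j).continuousOn.continuousAt hbn
  obtain ⟨hp1, hq1⟩ := hb.2.2.2.2.2
  have e3 : ∀ᶠ w in 𝓝 z, ∀ j, ‖kernelParam w j‖ * R < 1 := eventually_all.2 fun j =>
    ((hc j).norm.mul continuousAt_const).eventually_lt continuousAt_const (h3 j)
  have e5 : ∀ᶠ w in 𝓝 z, ∀ j k, ConstrainedPair j k →
      pochOn univ (kernelParam w j * kernelParam w k) (baseP w) (baseQ w) ≠ 0 := by
    refine eventually_all.2 fun j => eventually_all.2 fun k => ?_
    by_cases hjk : ConstrainedPair j k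
    · filter_upwards [eventually_pochOn_ne_zero univ ((hc j).mul (hc k)) hp hq hp1 hq1
        (h5 j k hjk)] with w hw _ using hw
    · exact Eventually.of_forall fun w h => absurd h hjk
  have e6 : ∀ᶠ w in 𝓝 z, ∀ i,
      pochOn univ (kernelParam w (.inr i) ^ 2 * (baseP w * baseQ w)) (baseP w) (baseQ w) ≠ 0 :=
    eventually_all.2 fun i => eventually_pochOn_ne_zero univ
      (((hc _).pow 2).mul (hp.mul hq)) hp hq hp1 hq1 (h6 i)
  filter_upwards [hbn, ht.norm.eventually_lt continuousAt_const h1,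
    hp.norm.eventually_lt (((hq.inv₀ hq0).mul ht).norm.mul continuousAt_const) h2, e3,
    eventually_pochOn_ne_zero univ ((hp.mul hq).mul (ht.inv₀ ht0)) hp hq hp1 hq1 h4, e5, e6]
    with w w1 w2 w3 w4 w5 w6 w7
  exact (mem_continuationDomain_iff hR).2 ⟨w1, w2, w3, w4, w5, w6, w7⟩

theorem norm_kernelParam_lt_one_of_mem_initialRegion {R : ℝ} {z : Vars m}
    (hz : z ∈ initialRegion m R) : z ∈ baseRegion m ∧ ‖baseT z‖ < R ^ 2 ∧
      ‖baseP z‖ < ‖(baseQ z)⁻¹ * baseT z‖ ∧ (∀ j, ‖kernelParam z j‖ < 1) ∧ ∀ i, ‖z.1 i‖ = 1 := by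
  obtain ⟨x, a, u, v, τ⟩ := z
  obtain ⟨⟨hp0, hq0, ht0, hq, ht⟩, hp, ha, hx⟩ := hz
  rw [lt_min_iff] at hp
  have hu : u ≠ 0 := fun h => hp0 (by simp [h])
  have hv : v ≠ 0 := fun h => hq0 (by simp [h])
  have hτ : τ ≠ 0 := fun h => ht0 (by simp [h])
  refine ⟨⟨hu, hv, hτ, fun s => (ha s).1, fun i h => ?_, hp.1, hq⟩, ht, hp.2, ?_, hx⟩
  · have := hx i
    change x i = 0 at h
    simp [h] at this
  -- The condition `|p| < |q⁻¹ t|` is the square of this bound.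
  have hs : ‖u * v * τ⁻¹‖ < 1 := by
    have h1 := hp.2
    have hv' : 0 < ‖v‖ := norm_pos_iff.2 hv
    have hτ' : 0 < ‖τ‖ := norm_pos_iff.2 hτ
    simp only [norm_pow, norm_mul, norm_inv] at h1 ⊢
    rw [← div_eq_mul_inv, div_lt_one hτ']
    rw [inv_mul_eq_div, lt_div_iff₀ (by positivity), ← mul_pow] at h1
    exact lt_of_pow_lt_pow_left₀ 2 hτ'.le h1
  rintro (s | ⟨i, ε⟩)
  · have := (ha s).2
    have h0 : 0 < ‖a s‖ := norm_pos_iff.2 (ha s).1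
    simp only [kernelParam, dualParams]
    rwa [norm_mul _ (a s)⁻¹, norm_inv, ← div_eq_mul_inv, div_lt_one h0]
  · simp only [kernelParam]
    rwa [norm_mul _ (x i ^ (ε : ℤ)), norm_zpow, hx i, one_zpow, mul_one]

/-- Here `|c_j| < 1` and `|pq/t| < 1`, so every argument of a shifted factorial lies in the unit
disc and none of them vanishes. -/
theorem initialRegion_subset_continuationDomain {R : ℝ} (hR : 0 < R) (hR1 : R ≤ 1) :
    initialRegion m R ⊆ continuationDomain m R := by
  intro z hz
  obtain ⟨hb, ht, hp, hc, -⟩ := norm_kernelParam_lt_one_of_mem_initialRegion hz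
  obtain ⟨hu, hv, hτ, -, -, hp1, hq1⟩ := id hb
  have hmul : ∀ a b : ℂ, ‖a‖ < 1 → ‖b‖ < 1 → ‖a * b‖ < 1 := fun a b h1 h2 => by
    rw [norm_mul]; exact mul_lt_one_of_nonneg_of_lt_one_left (norm_nonneg _) h1 h2.le
  have hR2 : 1 ≤ (R ^ 2)⁻¹ := (one_le_inv₀ (by positivity)).2 (pow_le_one₀ hR.le hR1)
  refine (mem_continuationDomain_iff hR).2 ⟨hb, ht, hp.trans_le ?_, fun j => ?_, ?_, ?_, ?_⟩
  · exact le_mul_of_one_le_right (norm_nonneg _) hR2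
  · exact mul_lt_one_of_nonneg_of_lt_one_left (norm_nonneg _) (hc j) hR1
  · refine pochOn_ne_zero_of_norm_lt_one _ ?_ hp1 hq1
    have hq' : 0 < ‖baseQ z‖ := norm_pos_iff.2 (pow_ne_zero _ hv)
    have ht' : 0 < ‖baseT z‖ := norm_pos_iff.2 (pow_ne_zero _ hτ)
    rw [norm_mul, norm_inv, inv_mul_eq_div, lt_div_iff₀ hq'] at hp
    rw [norm_mul, norm_mul, norm_inv, ← div_eq_mul_inv, div_lt_one ht']
    exact hp
  · exact fun j k _ => pochOn_ne_zero_of_norm_lt_one _ (hmul _ _ (hc j) (hc k)) hp1 hq1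
  · intro i
    refine pochOn_ne_zero_of_norm_lt_one _ (hmul _ _ ?_ (hmul _ _ hp1 hq1)) hp1 hq1
    rw [pow_two]
    exact hmul _ _ (hc _) (hc _)

/-- Variables for which no pole of the integrand inside the contour meets a pole outside. -/
def unpinched (m : ℕ) : Set (Vars m) :=
  {z | ∀ j k, pochOn univ (kernelParam z j * kernelParam z k) (baseP z) (baseQ z) ≠ 0}

/-- Rescaling of the variables `x`. -/
def scaleX (z : Vars m) (r : ℝ) : Vars m := (fun i => r * z.1 i, z.2)

theorem continuous_scaleX (z : Vars m) : Continuous (scaleX z) := by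
  unfold scaleX; fun_prop

/-- The only product of distinct parameters not constrained directly is that of `(pq/t)^{1/2} x_i`
and `(pq/t)^{1/2} x_i⁻¹`. It equals `pq/t` and is covered by the condition on `t`. Hence only a
parameter from `x` paired with itself can pinch. -/
theorem pochOn_kernelParam_ne_zero_of_mem_continuationDomain {R : ℝ} (hR : 0 < R) {z : Vars m}
    (hz : z ∈ continuationDomain m R) {j k : ParamIdx m}
    (hjk : ∀ i, ¬(j = .inr i ∧ k = .inr i)) :
    pochOn univ (kernelParam z j * kernelParam z k) (baseP z) (baseQ z) ≠ 0 := by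
  obtain ⟨hb, -, -, -, h4, h5, -⟩ := (mem_continuationDomain_iff hR).1 hz
  by_cases h : ConstrainedPair j k
  · exact h5 j k h
  rcases j with s | ⟨i, ε⟩
  · exact absurd trivial h
  rcases k with s | ⟨i', ε'⟩
  · exact absurd trivial h
  obtain rfl : i = i' := not_not.1 h
  have hε : ε' = -ε := by
    rcases Int.units_eq_one_or ε with rfl | rfl <;> rcases Int.units_eq_one_or ε' with rfl | rfl
    · exact absurd ⟨rfl, rfl⟩ (hjk _)
    · rfl
    · simp
    · exact absurd ⟨rfl, rfl⟩ (hjk _)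
  have he : kernelParam z (.inr (i, ε)) * kernelParam z (.inr (i, ε')) =
      baseP z * baseQ z * (baseT z)⁻¹ := by
    have h0 := zpow_ne_zero (ε : ℤ) (hb.2.2.2.2.1 i)
    simp only [kernelParam, hε, baseP, baseQ, baseT, Units.val_neg, zpow_neg]
    field_simp
  rwa [he]

/-- Replace `x` by `r x` with `r > 0` near `1`. Each relation `c_i² p^μ q^ν = 1` holds for at most
one such `r`, and there are countably many relations, so values of `r` arbitrarily close to `1`
avoid them all. -/
theorem subset_closure_unpinched {R : ℝ} (hR : 0 < R) :
    continuationDomain m R ⊆ closure (continuationDomain m R ∩ unpinched m) := by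
  intro z hz
  have hb := ((mem_continuationDomain_iff hR).1 hz).1
  let bad : Set ℝ := ⋃ (i : Fin m × ℤˣ) (ij : ℕ × ℕ), {r | 0 < r ∧
    kernelParam (scaleX z r) (.inr i) ^ 2 * baseP z ^ ij.1 * baseQ z ^ ij.2 = 1}
  have hbad : bad.Countable := by
    refine countable_iUnion fun i => countable_iUnion fun ij => Set.Subsingleton.countable ?_
    rintro r ⟨hr, h1⟩ s ⟨hs, h2⟩
    obtain ⟨i, ε⟩ := i
    have hk : ∀ r : ℝ, kernelParam (scaleX z r) (.inr (i, ε)) =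
        kernelParam z (.inr (i, ε)) * (r : ℂ) ^ (ε : ℤ) := fun r => by
      simp only [kernelParam, scaleX, mul_zpow]; ring
    rw [hk] at h1 h2
    have hne : kernelParam z (.inr (i, ε)) ^ 2 * baseP z ^ ij.1 * baseQ z ^ ij.2 ≠ 0 := by
      intro h
      rw [mul_pow, mul_right_comm, mul_right_comm, mul_right_comm, mul_right_comm] at h1
      have : kernelParam z (.inr (i, ε)) ^ 2 * baseP z ^ ij.1 * baseQ z ^ ij.2 *
        ((r : ℂ) ^ (ε : ℤ)) ^ 2 = 1 := by linear_combination h1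
      simp [h] at this
    have h3 : ((r : ℂ) ^ (ε : ℤ)) ^ 2 = ((s : ℂ) ^ (ε : ℤ)) ^ 2 :=
      mul_left_cancel₀ hne (by linear_combination h1 - h2)
    have h4 : (r ^ (ε : ℤ)) ^ 2 = (s ^ (ε : ℤ)) ^ 2 := by exact_mod_cast h3
    have h5 : r ^ (ε : ℤ) = s ^ (ε : ℤ) :=
      (pow_left_inj₀ (zpow_pos hr _).le (zpow_pos hs _).le two_ne_zero).1 h4
    rcases Int.units_eq_one_or ε with rfl | rfl
    · simpa using h5
    · simpa using h5
  have hdense : Dense badᶜ := hbad.dense_compl ℝ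
  have h1 : scaleX z 1 = z := by simp [scaleX]
  have hnhds : ∀ᶠ r : ℝ in 𝓝 1, 0 < r ∧ scaleX z r ∈ continuationDomain m R := by
    refine (lt_mem_nhds one_pos).and ((continuous_scaleX z).continuousAt.eventually ?_)
    rw [h1]
    exact (isOpen_continuationDomain hR).mem_nhds hz
  have hfreq : ∃ᶠ r : ℝ in 𝓝 1, scaleX z r ∈ continuationDomain m R ∩ unpinched m := by
    refine ((mem_closure_iff_frequently.1 (hdense 1)).and_eventually hnhds).mono ?_
    rintro r ⟨hr, hr0, hrD⟩
    refine ⟨hrD, fun j k => ?_⟩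
    by_cases hjk : ∀ i, ¬(j = .inr i ∧ k = .inr i)
    · exact pochOn_kernelParam_ne_zero_of_mem_continuationDomain hR hrD hjk
    · push Not at hjk
      obtain ⟨i, rfl, rfl⟩ := hjk
      have hb' := ((mem_continuationDomain_iff hR).1 hrD).1
      rw [pochOn_ne_zero_iff hb'.2.2.2.2.2.1 hb'.2.2.2.2.2.2]
      intro ij _ he
      refine hr (mem_iUnion₂.2 ⟨i, ij, hr0, ?_⟩)
      rw [pow_two]
      exact he
  have hcont := (continuous_scaleX z).continuousAt (x := 1)
  rw [ContinuousAt, h1] at hcont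
  exact mem_closure_iff_frequently.2 (hcont.frequently hfreq)

end RegionTopology

end VanDiejen

/-! ### Membership in an ideal generated by two functions. -/

section HolomorphicCombinations

variable {E : Type*} [NormedAddCommGroup E] [NormedSpace ℂ E] {Ω : Set E}

/-- `N` is a combination of `P` and `Q` with coefficients holomorphic on `Ω`. -/
def HolComb (Ω : Set E) (P Q N : E → ℂ) : Prop :=
  ∃ A B : E → ℂ, DifferentiableOn ℂ A Ω ∧ DifferentiableOn ℂ B Ω ∧
    ∀ w ∈ Ω, N w = A w * P w + B w * Q w

theorem HolComb.symm {P Q N : E → ℂ} (h : HolComb Ω P Q N) : HolComb Ω Q P N := by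
  obtain ⟨A, B, hA, hB, h⟩ := h
  exact ⟨B, A, hB, hA, fun w hw => by rw [h w hw, add_comm]⟩

theorem HolComb.mul_left {P Q N M : E → ℂ} (h : HolComb Ω P Q N) (hM : DifferentiableOn ℂ M Ω) :
    HolComb Ω P Q fun w => M w * N w := by
  obtain ⟨A, B, hA, hB, h⟩ := h
  exact ⟨fun w => M w * A w, fun w => M w * B w, hM.mul hA, hM.mul hB,
    fun w hw => by dsimp only; rw [h w hw]; ring⟩

/-- In `(AP + BQ)(A'P + B'Q')` every term except `BB'QQ'` is divisible by `P`. -/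
theorem HolComb.mul {P Q Q' N N' : E → ℂ} (h : HolComb Ω P Q N) (h' : HolComb Ω P Q' N')
    (hP : DifferentiableOn ℂ P Ω) (hQ : DifferentiableOn ℂ Q Ω) (hQ' : DifferentiableOn ℂ Q' Ω) :
    HolComb Ω P (fun w => Q w * Q' w) fun w => N w * N' w := by
  obtain ⟨A, B, hA, hB, h⟩ := h
  obtain ⟨A', B', hA', hB', h'⟩ := h'
  refine ⟨fun w => A w * (A' w * P w + B' w * Q' w) + B w * Q w * A' w, fun w => B w * B' w,
    (hA.mul ((hA'.mul hP).add (hB'.mul hQ'))).add ((hB.mul hQ).mul hA'), hB.mul hB',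
    fun w hw => ?_⟩
  dsimp only
  rw [h w hw, h' w hw]
  ring

theorem HolComb.prod {ι : Type*} (T : Finset ι) {P : E → ℂ} {Q N : ι → E → ℂ}
    (hP : DifferentiableOn ℂ P Ω) (hQ : ∀ b ∈ T, DifferentiableOn ℂ (Q b) Ω)
    (h : ∀ b ∈ T, HolComb Ω P (Q b) (N b)) :
    HolComb Ω P (fun w => ∏ b ∈ T, Q b w) fun w => ∏ b ∈ T, N b w := by
  classical
  induction T using Finset.induction_on with
  | empty =>
    exact ⟨fun _ => 0, fun _ => 1, differentiableOn_const _, differentiableOn_const _,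
      fun w _ => by simp⟩
  | insert b T hb ih =>
    simp only [Finset.prod_insert hb]
    refine (h b (Finset.mem_insert_self b T)).mul
      (ih (fun c hc => hQ c (Finset.mem_insert_of_mem hc))
        fun c hc => h c (Finset.mem_insert_of_mem hc)) hP (hQ b (Finset.mem_insert_self b T)) ?_
    exact DifferentiableOn.finset_prod_of_normed T fun c hc => hQ c (Finset.mem_insert_of_mem hc)

/-- Reduces the joint partial fraction problem to single pairs of poles. The price is one numerator
factor for each pair `(a, b)`, so every pinched pair needs a zero of its own. -/
theorem HolComb.prod_prod {ι : Type*} (S T : Finset ι) {P Q : ι → E → ℂ} {N : ι → ι → E → ℂ}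
    (hP : ∀ a ∈ S, DifferentiableOn ℂ (P a) Ω) (hQ : ∀ b ∈ T, DifferentiableOn ℂ (Q b) Ω)
    (h : ∀ a ∈ S, ∀ b ∈ T, HolComb Ω (P a) (Q b) (N a b)) :
    HolComb Ω (fun w => ∏ a ∈ S, P a w) (fun w => ∏ b ∈ T, Q b w)
      fun w => ∏ a ∈ S, ∏ b ∈ T, N a b w :=
  (HolComb.prod S (DifferentiableOn.finset_prod_of_normed T hQ) hP fun a ha =>
    (HolComb.prod T (hP a ha) hQ (h a ha)).symm).symm

variable {α β Y s r : E → ℂ}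

/-- `1 - αβ = βY (1 - α/Y) + (1 - βY)`, and the left side is invertible. -/
theorem holComb_one (hα : DifferentiableOn ℂ α Ω) (hβ : DifferentiableOn ℂ β Ω)
    (hY : DifferentiableOn ℂ Y Ω) (hY0 : ∀ w ∈ Ω, Y w ≠ 0) (h : ∀ w ∈ Ω, α w * β w ≠ 1) :
    HolComb Ω (fun w => 1 - α w * (Y w)⁻¹) (fun w => 1 - β w * Y w) fun _ => 1 := by
  have hi : DifferentiableOn ℂ (fun w => (1 - α w * β w)⁻¹) Ω :=
    ((hα.mul hβ).const_sub 1).fun_inv fun w hw => sub_ne_zero.2 (h w hw).symm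
  refine ⟨fun w => (1 - α w * β w)⁻¹ * (β w * Y w), fun w => (1 - α w * β w)⁻¹,
    hi.mul (hβ.mul hY), hi, fun w hw => ?_⟩
  have h1 : 1 - α w * β w ≠ 0 := sub_ne_zero.2 (h w hw).symm
  have h2 := hY0 w hw
  field_simp
  ring

/-- A zero of the numerator compensates a pair of poles which are about to coincide. -/
theorem holComb_of_sq {c : ℂ} (hc : c ^ 2 = 1) (hβ : DifferentiableOn ℂ β Ω)
    (hY : DifferentiableOn ℂ Y Ω) (hs : DifferentiableOn ℂ s Ω) (hr : DifferentiableOn ℂ r Ω)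
    (hY0 : ∀ w ∈ Ω, Y w ≠ 0) (hsc : ∀ w ∈ Ω, s w + c ≠ 0) (hαβ : ∀ w ∈ Ω, α w * β w = s w ^ 2)
    (hβr : ∀ w ∈ Ω, β w = s w * r w) :
    HolComb Ω (fun w => 1 - α w * (Y w)⁻¹) (fun w => 1 - β w * Y w) fun w => 1 - c * r w * Y w := by
  have hi : DifferentiableOn ℂ (fun w => (s w + c)⁻¹) Ω := (hs.add_const c).fun_inv hsc
  -- As `β = s r`, one has `1 - c r Y = (1 - βY) - rY (c - s)`. Here `c - s = (1 - s²)/(s + c)`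
  -- because `c² = 1`, and `1 - s² = 1 - αβ` is the combination used in `holComb_one`. No division
  -- by `1 - αβ` occurs, only by `s + c`.
  refine ⟨fun w => -(r w * Y w * (s w + c)⁻¹ * (β w * Y w)),
    fun w => 1 - r w * Y w * (s w + c)⁻¹, (((hr.mul hY).mul hi).mul (hβ.mul hY)).fun_neg,
    ((hr.mul hY).mul hi).const_sub 1, fun w hw => ?_⟩
  have h1 := hsc w hw
  have h2 := hY0 w hw
  have h3 : α w * (Y w)⁻¹ * (β w * Y w) = s w ^ 2 := by
    rw [← hαβ w hw]; field_simp
  have h4 : r w * Y w * (s w + c)⁻¹ * (c ^ 2 - s w ^ 2) = r w * Y w * (c - s w) := by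
    field_simp
    ring
  have h5 := hβr w hw
  have h6 : 1 - c * r w * Y w = (1 - β w * Y w) - r w * Y w * (c - s w) := by rw [h5]; ring
  dsimp only
  rw [h6, ← h4, hc, ← h3]
  ring

end HolomorphicCombinations

namespace VanDiejen

/-! ### Assigning to each pinched pair of poles its own zero of the numerator. -/

noncomputable section FactorAssignment

variable {m : ℕ}

/-- Indices `(j, (μ, ν))` of the poles `c_j p^μ q^ν`. -/
abbrev PoleIdx (m : ℕ) : Type := ParamIdx m × (ℕ × ℕ)

/-- The pole `c_j p^μ q^ν`. -/
def pole (z : Vars m) (a : PoleIdx m) : ℂ :=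
  kernelParam z a.1 * baseP z ^ a.2.1 * baseQ z ^ a.2.2

/-- The square root `c_j p^{(μ + μ')/2} q^{(ν + ν')/2}` of the product of two poles. -/
def poleRoot (z : Vars m) (a b : PoleIdx m) : ℂ :=
  kernelParam z a.1 * z.2.2.1 ^ (a.2.1 + b.2.1) * z.2.2.2.1 ^ (a.2.2 + b.2.2)

theorem pole_mul_pole (z : Vars m) {a b : PoleIdx m} (h : a.1 = b.1) :
    pole z a * pole z b = poleRoot z a b ^ 2 := by
  simp only [pole, poleRoot, baseP, baseQ, h]
  ring

/-- The sign of the square root of the product of two coinciding poles. -/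
def poleSign (z : Vars m) (a b : PoleIdx m) : ℤˣ :=
  open Classical in if poleRoot z a b = 1 then 1 else -1

theorem poleSign_eq {z : Vars m} {a b : PoleIdx m} (h : a.1 = b.1) (hab : pole z a * pole z b = 1) :
    ((poleSign z a b : ℤ) : ℂ) = poleRoot z a b := by
  rw [pole_mul_pole z h] at hab
  have hab := sq_eq_one_iff.1 hab
  unfold poleSign
  split_ifs with h1
  · simp [h1]
  · simp [hab.resolve_left h1]

/-- Indices `(±, ±, (i, j))` of the zeros of the numerator. -/
abbrev ZeroIdx : Type := ℤˣ × ℤˣ × (ℕ × ℕ)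

/-- The linear factor `1 ∓ p^{i/2} q^{j/2} y^±` of the numerator. -/
def zeroFactor (f : ZeroIdx) (y : ℂ) (z : Vars m) : ℂ :=
  1 - ((f.2.1 : ℤ) : ℂ) * (z.2.2.1 ^ f.2.2.1 * z.2.2.2.1 ^ f.2.2.2) * y ^ (f.1 : ℤ)

/-- The zero of the numerator compensating a pair of coinciding poles. -/
def compensatingZero (z : Vars m) (a b : PoleIdx m) : ZeroIdx :=
  if a.2.1 = 0 ∧ b.2.1 = 0 then
    if a.2.2 ≤ b.2.2 then (1, poleSign z a b, (0, b.2.2 - a.2.2))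
    else (-1, poleSign z a b, (0, a.2.2 - b.2.2))
  else
    if a.2.1 < b.2.1 then (1, poleSign z a b, (b.2.1 - a.2.1, 0))
    else (-1, poleSign z a b, (a.2.1 - b.2.1, 0))

/-- Both restrictions come from the domain: products of distinct parameters never pinch, and `c² pq
p^k q^l ≠ 1` for `k, l ≥ 0` keeps the remaining coincidences on one axis. The axes are where the
numerator has its zeros. -/
theorem eq_and_exponents_of_pole_mul_pole_eq_one {R : ℝ} (hR : 0 < R) {z : Vars m}
    (hz : z ∈ continuationDomain m R) {a b : PoleIdx m} (hab : pole z a * pole z b = 1) :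
    a.1 = b.1 ∧ (a.2.1 = 0 ∧ b.2.1 = 0 ∨ a.2.2 = 0 ∧ b.2.2 = 0) := by
  obtain ⟨hb, -, -, -, -, -, h6⟩ := (mem_continuationDomain_iff hR).1 hz
  obtain ⟨hp1, hq1⟩ := hb.2.2.2.2.2
  have e1 : kernelParam z a.1 * kernelParam z b.1 * baseP z ^ (a.2.1 + b.2.1) *
      baseQ z ^ (a.2.2 + b.2.2) = 1 := by
    rw [← hab, pole, pole]; ring
  by_cases hjk : ∀ i, ¬(a.1 = .inr i ∧ b.1 = .inr i)
  · have := pochOn_kernelParam_ne_zero_of_mem_continuationDomain hR hz hjk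
    rw [pochOn_ne_zero_iff hp1 hq1] at this
    exact absurd e1 (this (a.2.1 + b.2.1, a.2.2 + b.2.2) (mem_univ _))
  · push Not at hjk
    obtain ⟨i, h1, h2⟩ := hjk
    refine ⟨h1.trans h2.symm, ?_⟩
    by_contra hne
    have h := h6 i
    rw [pochOn_ne_zero_iff hp1 hq1] at h
    -- Off the axes both exponent sums are positive; splitting off one `pq` gives a relation
    -- excluded by `h6`.
    obtain ⟨k, hk⟩ : ∃ k, a.2.1 + b.2.1 = k + 1 := ⟨a.2.1 + b.2.1 - 1, by omega⟩
    obtain ⟨l, hl⟩ : ∃ l, a.2.2 + b.2.2 = l + 1 := ⟨a.2.2 + b.2.2 - 1, by omega⟩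
    refine h (k, l) (mem_univ _) ?_
    rw [h1, h2, hk, hl] at e1
    linear_combination e1

/-- Multiplying two roots with the same value `c` gives `c² = 1`. Even exponent sums turn the left
side into a product of two genuine poles, and such a pinch forces equal indices. -/
theorem paramIdx_eq_of_root_eq {R : ℝ} (hR : 0 < R) {z : Vars m}
    (hz : z ∈ continuationDomain m R) {j k : ParamIdx m} {c : ℂ} (hc : c ^ 2 = 1) {e e' : ℕ × ℕ}
    (h : kernelParam z j * z.2.2.1 ^ e.1 * z.2.2.2.1 ^ e.2 = c)
    (h' : kernelParam z k * z.2.2.1 ^ e'.1 * z.2.2.2.1 ^ e'.2 = c)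
    (h1 : Even (e.1 + e'.1)) (h2 : Even (e.2 + e'.2)) : j = k := by
  obtain ⟨i, hi⟩ := h1
  obtain ⟨l, hl⟩ := h2
  refine (eq_and_exponents_of_pole_mul_pole_eq_one hR hz (a := (j, (i, l))) (b := (k, (0, 0))) ?_).1
  have e1 : z.2.2.1 ^ e.1 * z.2.2.1 ^ e'.1 = baseP z ^ i := by
    rw [← pow_add, hi, baseP, ← pow_mul, two_mul]
  have e2 : z.2.2.2.1 ^ e.2 * z.2.2.2.1 ^ e'.2 = baseQ z ^ l := by
    rw [← pow_add, hl, baseQ, ← pow_mul, two_mul]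
  simp only [pole, pow_zero, mul_one]
  rw [← e1, ← e2, ← hc, pow_two]
  nth_rewrite 1 [← h]
  rw [← h']
  ring

theorem pow_injective_of_norm_lt_one {u : ℂ} (hu : u ≠ 0) (hu1 : ‖u ^ 2‖ < 1) :
    Function.Injective fun n : ℕ => u ^ n := by
  intro i j h
  have hu' : ‖u‖ < 1 := by
    rw [norm_pow] at hu1
    exact (pow_lt_one_iff_of_nonneg (norm_nonneg _) two_ne_zero).1 hu1
  have := congrArg norm h
  simp only [norm_pow] at this
  exact pow_right_injective₀ (norm_pos_iff.2 hu) hu'.ne this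

/-- The zero determines the difference of the exponents and the sign, that is, the value of
`poleRoot`. Equal signs force equal parameters, after which the root determines the sum of the
exponents, because `|p|, |q| < 1`. Sum and difference recover the pair. -/
theorem injOn_compensatingZero {R : ℝ} (hR : 0 < R) {z : Vars m}
    (hz : z ∈ continuationDomain m R) :
    InjOn (fun x : PoleIdx m × PoleIdx m => compensatingZero z x.1 x.2)
      {x | pole z x.1 * pole z x.2 = 1} := by
  rintro ⟨⟨j, μ, ν⟩, ⟨j', μ', ν'⟩⟩ h ⟨⟨k, κ, l⟩, ⟨k', κ', l'⟩⟩ h' he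
  simp only [mem_ofPred_eq] at h h'
  obtain ⟨hj, hx⟩ := eq_and_exponents_of_pole_mul_pole_eq_one hR hz h
  obtain ⟨hk, hx'⟩ := eq_and_exponents_of_pole_mul_pole_eq_one hR hz h'
  obtain ⟨hu, hv, -, -, -, hp1, hq1⟩ := ((mem_continuationDomain_iff hR).1 hz).1
  have hs := poleSign_eq hj h
  have hs' := poleSign_eq hk h'
  have hsq := pole_mul_pole z hj
  rw [h] at hsq
  -- In `compensatingZero` ties go to `y` on the `q`-axis and to `y⁻¹` on the `p`-axis. Hence zeros
  -- coming from different axes never have the same index, and the mixed cases are void.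
  have hkey : poleSign z (j, μ, ν) (j', μ', ν') = poleSign z (k, κ, l) (k', κ', l') ∧
      (μ = 0 ∧ μ' = 0 ∧ κ = 0 ∧ κ' = 0 ∧ (ν : ℤ) - ν' = l - l' ∨
        ν = 0 ∧ ν' = 0 ∧ l = 0 ∧ l' = 0 ∧ (μ : ℤ) - μ' = κ - κ') := by
    simp only [compensatingZero] at he
    have h11 : (1 : ℤˣ) ≠ -1 := by decide
    split_ifs at he <;> simp only [Prod.mk.injEq, h11, h11.symm, false_and, true_and] at he <;>
      (refine ⟨he.1, ?_⟩; dsimp only at hx hx'; omega)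
  obtain ⟨hsgn, hkey⟩ := hkey
  rw [hsgn, hs'] at hs
  -- Equal differences give sums of equal parity, so the half-integer exponents combine to integral
  -- ones.
  have hparity : Even ((μ + μ') + (κ + κ')) ∧ Even ((ν + ν') + (l + l')) := by
    constructor <;> rw [Nat.even_iff] <;> omega
  dsimp only at hj hk
  subst hj hk
  have hjk : j = k := paramIdx_eq_of_root_eq hR hz hsq.symm (e := (μ + μ', ν + ν'))
    (e' := (κ + κ', l + l')) rfl hs hparity.1 hparity.2
  subst hjk
  have hc := kernelParam_ne_zero ((mem_continuationDomain_iff hR).1 hz).1 j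
  simp only [poleRoot, mul_assoc] at hs
  have hs := mul_left_cancel₀ hc hs
  rcases hkey with ⟨rfl, rfl, rfl, rfl, hd⟩ | ⟨rfl, rfl, rfl, rfl, hd⟩
  · simp only [add_zero, pow_zero, one_mul] at hs
    have := pow_injective_of_norm_lt_one hv hq1 hs
    obtain ⟨rfl, rfl⟩ : ν = l ∧ ν' = l' := by omega
    rfl
  · simp only [add_zero, pow_zero, mul_one] at hs
    have := pow_injective_of_norm_lt_one hu hp1 hs
    obtain ⟨rfl, rfl⟩ : μ = κ ∧ μ' = κ' := by omega
    rfl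

end FactorAssignment

end VanDiejen

namespace VanDiejen

/-! ### Separating finitely many poles and zeros from an invertible tail. -/

noncomputable section LocalDecomposition

variable {m : ℕ}

/-- The factor of the integrand depending on a single variable `y`. -/
def oneVarWeight (y : ℂ) (z : Vars m) : ℂ :=
  thetaPair (y ^ 2) (baseP z) (baseQ z) *
    ∏ j, (ellGamma (kernelParam z j * y) (baseP z) (baseQ z) *
      ellGamma (kernelParam z j * y⁻¹) (baseP z) (baseQ z))

/-- Poles of the integrand which stay outside of the contour. -/
def outerPoles (z : Vars m) : Set ℂ :=
  {y | ∏ j, pochOn univ (kernelParam z j * y) (baseP z) (baseQ z) = 0}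

/-- Poles of the integrand which stay inside of the contour. -/
def innerPoles (z : Vars m) : Set ℂ :=
  {y | ∏ j, pochOn univ (kernelParam z j * y⁻¹) (baseP z) (baseQ z) = 0}

/-- The box of exponents less than `N`. -/
def expBox (N : ℕ) : Finset (ℕ × ℕ) := Finset.range N ×ˢ Finset.range N

/-- Exponents one of which vanishes. -/
def axisSet : Set (ℕ × ℕ) := {ij | ij.1 = 0 ∨ ij.2 = 0}

/-- Exponents in the box one of which vanishes. -/
def axisBox (N : ℕ) : Finset (ℕ × ℕ) := {ij ∈ expBox N | ij.1 = 0 ∨ ij.2 = 0}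

theorem pochOn_eq_prod_mul_tail {S : Set (ℕ × ℕ)} {B : Finset (ℕ × ℕ)} (hB : (B : Set (ℕ × ℕ)) ⊆ S)
    (a : ℂ) {p q : ℂ} (hp : ‖p‖ < 1) (hq : ‖q‖ < 1) :
    pochOn S a p q = (∏ ij ∈ B, (1 - a * p ^ ij.1 * q ^ ij.2)) * pochOn (S \ B) a p q := by
  rw [← pochOn_finset, pochOn_mul_pochOn disjoint_sdiff_right a hp hq, union_sdiff_cancel hB]

theorem thetaPair_eq (w : ℂ) {p q : ℂ} (hp : ‖p‖ < 1) (hq : ‖q‖ < 1) :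
    thetaPair w p q = pochOn axisSet w p q * pochOn axisSet w⁻¹ p q := by
  have h : ∀ a, pochOn axisSet a p q =
      pochOn {ij | ij.1 = 0} a p q * pochOn {ij | 0 < ij.1 ∧ ij.2 = 0} a p q := fun a => by
    rw [pochOn_mul_pochOn _ _ hp hq]
    · congr 1
      ext ⟨i, j⟩
      simp [axisSet]
      omega
    · rw [disjoint_left]
      rintro ⟨i, j⟩ h
      simp at h ⊢
      omega
  rw [h, h, thetaPair]
  ring

/-- The product of the linear factors of the numerator with exponents in the box. -/
def zeroProduct (N : ℕ) (y : ℂ) (z : Vars m) : ℂ :=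
  ∏ f ∈ (Finset.univ : Finset ℤˣ) ×ˢ ((Finset.univ : Finset ℤˣ) ×ˢ axisBox N), zeroFactor f y z

theorem prod_units_int {M : Type*} [CommMonoid M] (f : ℤˣ → M) : ∏ ε, f ε = f 1 * f (-1) := by
  rw [show (Finset.univ : Finset ℤˣ) = {1, -1} from rfl, Finset.prod_pair (by decide)]

theorem zeroProduct_eq (N : ℕ) (y : ℂ) (z : Vars m) :
    zeroProduct N y z =
      (∏ ij ∈ axisBox N, (1 - y ^ 2 * baseP z ^ ij.1 * baseQ z ^ ij.2)) *
        ∏ ij ∈ axisBox N, (1 - (y ^ 2)⁻¹ * baseP z ^ ij.1 * baseQ z ^ ij.2) := by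
  simp only [zeroProduct, Finset.prod_product, prod_units_int, ← Finset.prod_mul_distrib]
  refine Finset.prod_congr rfl fun ij _ => ?_
  simp only [zeroFactor, baseP, baseQ, Units.val_one, Units.val_neg, Int.cast_one, Int.cast_neg,
    zpow_one, zpow_neg]
  rw [← inv_pow]
  ring

theorem thetaPair_sq_eq (N : ℕ) (y : ℂ) {z : Vars m} (hp : ‖baseP z‖ < 1) (hq : ‖baseQ z‖ < 1) :
    thetaPair (y ^ 2) (baseP z) (baseQ z) = zeroProduct N y z *
      (pochOn (axisSet \ axisBox N) (y ^ 2) (baseP z) (baseQ z) *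
        pochOn (axisSet \ axisBox N) (y ^ 2)⁻¹ (baseP z) (baseQ z)) := by
  have hB : (axisBox N : Set (ℕ × ℕ)) ⊆ axisSet := fun ij h => by
    simp only [axisBox, Finset.coe_filter, mem_ofPred_eq] at h
    exact h.2
  rw [thetaPair_eq _ hp hq, pochOn_eq_prod_mul_tail hB _ hp hq,
    pochOn_eq_prod_mul_tail hB (y ^ 2)⁻¹ hp hq, zeroProduct_eq]
  ring

/-- The indices of the poles with exponents in the box. -/
def poleBox (m N : ℕ) : Finset (PoleIdx m) := Finset.univ ×ˢ expBox N

theorem prod_pochOn_eq (N : ℕ) (y : ℂ) {z : Vars m} (hp : ‖baseP z‖ < 1) (hq : ‖baseQ z‖ < 1) :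
    ∏ j, pochOn univ (kernelParam z j * y) (baseP z) (baseQ z) =
      (∏ a ∈ poleBox m N, (1 - pole z a * y)) *
        ∏ j, pochOn (univ \ expBox N) (kernelParam z j * y) (baseP z) (baseQ z) := by
  rw [poleBox, Finset.prod_product, ← Finset.prod_mul_distrib]
  refine Finset.prod_congr rfl fun j _ => ?_
  rw [pochOn_eq_prod_mul_tail (subset_univ (expBox N : Set (ℕ × ℕ))) _ hp hq]
  congr 1
  refine Finset.prod_congr rfl fun ij _ => ?_
  rw [pole]
  ring

/-- The part of the weight without poles and zeros indexed by the box. -/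
def weightTail (N : ℕ) (y : ℂ) (z : Vars m) : ℂ :=
  (pochOn (axisSet \ axisBox N) (y ^ 2) (baseP z) (baseQ z) *
    pochOn (axisSet \ axisBox N) (y ^ 2)⁻¹ (baseP z) (baseQ z)) *
  (∏ j, (pochOn univ (baseP z * baseQ z * (kernelParam z j * y)⁻¹) (baseP z) (baseQ z) *
    pochOn univ (baseP z * baseQ z * (kernelParam z j * y⁻¹)⁻¹) (baseP z) (baseQ z))) *
  ((∏ j, pochOn (univ \ expBox N) (kernelParam z j * y) (baseP z) (baseQ z)) *
    ∏ j, pochOn (univ \ expBox N) (kernelParam z j * y⁻¹) (baseP z) (baseQ z))⁻¹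

theorem oneVarWeight_eq (N : ℕ) (y : ℂ) {z : Vars m} (hp : ‖baseP z‖ < 1) (hq : ‖baseQ z‖ < 1) :
    oneVarWeight y z = zeroProduct N y z * weightTail N y z *
      ((∏ a ∈ poleBox m N, (1 - pole z a * y⁻¹)) * ∏ a ∈ poleBox m N, (1 - pole z a * y))⁻¹ := by
  rw [oneVarWeight, thetaPair_sq_eq N y hp hq, weightTail]
  simp only [ellGamma, pochhammer_eq_pochOn_univ, div_mul_div_comm, Finset.prod_div_distrib,
    Finset.prod_mul_distrib]
  rw [prod_pochOn_eq N y hp hq, prod_pochOn_eq N y⁻¹ hp hq]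
  simp only [div_eq_mul_inv, mul_inv]
  ring

/-- Outside the box some exponent is at least `N`. Since `|c_j| < R⁻¹ < σ⁻¹` and `|y^{±1}| < σ⁻¹`,
the terms `c_j y^{±1} p^i q^l` are smaller than `σ⁻² ρ^N < 1`, and the tail of the denominator
cannot vanish. -/
theorem differentiableOn_weightTail {R σ ρ : ℝ} (hσ : 0 < σ) (hσR : σ < R) (hR : 0 < R)
    (hρ : ρ < 1) {N : ℕ} (hN : ρ ^ N < σ ^ 2) {U : Set (Vars m)} (hU : U ⊆ continuationDomain m R)
    (hUp : ∀ z ∈ U, ‖baseP z‖ < ρ) (hUq : ∀ z ∈ U, ‖baseQ z‖ < ρ) :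
    DifferentiableOn ℂ (fun w : ℂ × Vars m => weightTail N w.1 w.2) (openAnnulus σ ×ˢ U) := by
  have hy : DifferentiableOn ℂ (fun w : ℂ × Vars m => w.1) (openAnnulus σ ×ˢ U) :=
    differentiableOn_fst
  have hy0 : ∀ w ∈ openAnnulus σ ×ˢ U, w.1 ≠ 0 := fun w hw =>
    norm_pos_iff.1 (hσ.trans hw.1.1)
  have hyi : DifferentiableOn ℂ (fun w : ℂ × Vars m => w.1⁻¹) (openAnnulus σ ×ˢ U) :=
    hy.fun_inv hy0
  have hyn : ∀ w ∈ openAnnulus σ ×ˢ U, ‖w.1‖ < σ⁻¹ ∧ ‖w.1⁻¹‖ < σ⁻¹ := fun w hw =>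
    ⟨hw.1.2, by rw [norm_inv]; exact inv_strictAnti₀ hσ hw.1.1⟩
  have hbase : ∀ w ∈ openAnnulus σ ×ˢ U, w.2 ∈ baseRegion m := fun w hw =>
    ((mem_continuationDomain_iff hR).1 (hU hw.2)).1
  have hp : DifferentiableOn ℂ (fun w : ℂ × Vars m => baseP w.2) (openAnnulus σ ×ˢ U) :=
    (differentiable_baseP.comp differentiable_snd).differentiableOn
  have hq : DifferentiableOn ℂ (fun w : ℂ × Vars m => baseQ w.2) (openAnnulus σ ×ˢ U) :=
    (differentiable_baseQ.comp differentiable_snd).differentiableOn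
  have hp1 : ∀ w ∈ openAnnulus σ ×ˢ U, ‖baseP w.2‖ < 1 := fun w hw => (hUp _ hw.2).trans hρ
  have hq1 : ∀ w ∈ openAnnulus σ ×ˢ U, ‖baseQ w.2‖ < 1 := fun w hw => (hUq _ hw.2).trans hρ
  have hc : ∀ j, DifferentiableOn ℂ (fun w : ℂ × Vars m => kernelParam w.2 j)
      (openAnnulus σ ×ˢ U) := fun j =>
    (differentiableOn_kernelParam j).comp differentiableOn_snd hbase
  have hc0 : ∀ j, ∀ w ∈ openAnnulus σ ×ˢ U, kernelParam w.2 j ≠ 0 := fun j w hw =>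
    kernelParam_ne_zero (hbase w hw) j
  have htail : ∀ (j : ParamIdx m) (w : ℂ × Vars m), w ∈ openAnnulus σ ×ˢ U → ∀ y : ℂ, ‖y‖ < σ⁻¹ →
      pochOn (univ \ expBox N) (kernelParam w.2 j * y) (baseP w.2) (baseQ w.2) ≠ 0 := by
    intro j w hw y hy
    rw [pochOn_ne_zero_iff (hp1 w hw) (hq1 w hw)]
    rintro ⟨i, l⟩ hil he
    have hil' : N ≤ i ∨ N ≤ l := by
      simp only [expBox, Finset.coe_product, Finset.coe_range, Set.mem_sdiff, mem_univ, mem_prod,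
        mem_Iio, true_and] at hil
      omega
    have hcn := ((mem_continuationDomain_iff hR).1 (hU hw.2)).2.2.2.1 j
    have hcn : ‖kernelParam w.2 j‖ < σ⁻¹ := by
      rw [← lt_div_iff₀ hR, one_div] at hcn
      exact hcn.trans (inv_strictAnti₀ hσ hσR)
    have hρ0 : 0 ≤ ρ := (norm_nonneg _).trans (hUp _ hw.2).le
    have hpow : ‖baseP w.2‖ ^ i * ‖baseQ w.2‖ ^ l ≤ ρ ^ N := by
      rcases hil' with h | h
      · calc ‖baseP w.2‖ ^ i * ‖baseQ w.2‖ ^ l ≤ ρ ^ i * 1 := by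
              gcongr
              · exact (hUp _ hw.2).le
              · exact pow_le_one₀ (norm_nonneg _) (hq1 w hw).le
          _ ≤ ρ ^ N := by rw [mul_one]; exact pow_le_pow_of_le_one hρ0 hρ.le h
      · calc ‖baseP w.2‖ ^ i * ‖baseQ w.2‖ ^ l ≤ 1 * ρ ^ l := by
              gcongr
              · exact pow_le_one₀ (norm_nonneg _) (hp1 w hw).le
              · exact (hUq _ hw.2).le
          _ ≤ ρ ^ N := by rw [one_mul]; exact pow_le_pow_of_le_one hρ0 hρ.le h
    have hlt : ‖kernelParam w.2 j * y * baseP w.2 ^ i * baseQ w.2 ^ l‖ < 1 := by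
      rw [norm_mul, norm_mul, norm_mul, norm_pow, norm_pow, mul_assoc]
      calc ‖kernelParam w.2 j‖ * ‖y‖ * (‖baseP w.2‖ ^ i * ‖baseQ w.2‖ ^ l)
          ≤ σ⁻¹ * σ⁻¹ * ρ ^ N := by gcongr
        _ < σ⁻¹ * σ⁻¹ * σ ^ 2 := by gcongr
        _ = 1 := by field_simp
    rw [he, norm_one] at hlt
    exact lt_irrefl _ hlt
  unfold weightTail
  refine DifferentiableOn.mul (DifferentiableOn.mul (DifferentiableOn.mul ?_ ?_) ?_) ?_
  · exact DifferentiableOn.pochOn _ (hy.fun_pow 2) hp hq hp1 hq1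
  · exact DifferentiableOn.pochOn _ ((hy.fun_pow 2).fun_inv fun w hw => pow_ne_zero _ (hy0 w hw))
      hp hq hp1 hq1
  · refine DifferentiableOn.finset_prod_of_normed _ fun j _ => DifferentiableOn.mul ?_ ?_
    · exact DifferentiableOn.pochOn _ ((hp.mul hq).mul (((hc j).mul hy).fun_inv fun w hw =>
        mul_ne_zero (hc0 j w hw) (hy0 w hw))) hp hq hp1 hq1
    · exact DifferentiableOn.pochOn _ ((hp.mul hq).mul (((hc j).mul hyi).fun_inv fun w hw =>
        mul_ne_zero (hc0 j w hw) (inv_ne_zero (hy0 w hw)))) hp hq hp1 hq1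
  · refine DifferentiableOn.fun_inv (DifferentiableOn.mul ?_ ?_) fun w hw => ?_
    · exact DifferentiableOn.finset_prod_of_normed _ fun j _ =>
        DifferentiableOn.pochOn _ ((hc j).mul hy) hp hq hp1 hq1
    · exact DifferentiableOn.finset_prod_of_normed _ fun j _ =>
        DifferentiableOn.pochOn _ ((hc j).mul hyi) hp hq hp1 hq1
    · exact mul_ne_zero (Finset.prod_ne_zero_iff.2 fun j _ => htail j w hw _ (hyn w hw).1)
        (Finset.prod_ne_zero_iff.2 fun j _ => htail j w hw _ (hyn w hw).2)

end LocalDecomposition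

end VanDiejen

namespace VanDiejen

/-! ### Local partial fractions of the one-variable weight. -/

noncomputable section LocalDecompositionExistence

variable {m : ℕ}

theorem compensatingZero_mem {N : ℕ} (z : Vars m) {a b : PoleIdx m} (ha : a ∈ poleBox m N)
    (hb : b ∈ poleBox m N) : compensatingZero z a b ∈
      (Finset.univ : Finset ℤˣ) ×ˢ ((Finset.univ : Finset ℤˣ) ×ˢ axisBox N) := by
  simp only [poleBox, expBox, Finset.mem_product, Finset.mem_univ, true_and, Finset.mem_range]
    at ha hb
  unfold compensatingZero
  split_ifs <;> simp only [Finset.mem_product, Finset.mem_univ, true_and, axisBox, expBox,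
    Finset.mem_filter, Finset.mem_range, true_or, or_true, and_true] <;> omega

variable {R σ : ℝ} {U : Set (Vars m)}

theorem differentiableOn_pole (hR : 0 < R) (hU : U ⊆ continuationDomain m R) (a : PoleIdx m) :
    DifferentiableOn ℂ (fun z => pole z a) U :=
  (((differentiableOn_kernelParam a.1).mono fun _ hz =>
    ((mem_continuationDomain_iff hR).1 (hU hz)).1).mul
      (differentiable_baseP.fun_pow _).differentiableOn).mul
      (differentiable_baseQ.fun_pow _).differentiableOn

theorem differentiableOn_poleRoot (hR : 0 < R) (hU : U ⊆ continuationDomain m R)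
    (a b : PoleIdx m) : DifferentiableOn ℂ (fun z => poleRoot z a b) U :=
  (((differentiableOn_kernelParam a.1).mono fun _ hz =>
    ((mem_continuationDomain_iff hR).1 (hU hz)).1).mul (by fun_prop)).mul (by fun_prop)

/-- An instance of `holComb_of_sq` with `s` the root of the product of the two poles and `c` its
value `±1` at `z₀`. The zero is fixed by `z₀`, while the identity holds for all `z` in `U`. -/
theorem holComb_zeroFactor (hR : 0 < R) (hσ : 0 < σ) (hU : U ⊆ continuationDomain m R)
    {z₀ : Vars m} (hz₀ : z₀ ∈ continuationDomain m R) {a b : PoleIdx m}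
    (hab : pole z₀ a * pole z₀ b = 1)
    (hpin : ∀ z ∈ U, poleRoot z a b + ((poleSign z₀ a b : ℤ) : ℂ) ≠ 0) :
    HolComb (openAnnulus σ ×ˢ U) (fun w => 1 - pole w.2 a * w.1⁻¹) (fun w => 1 - pole w.2 b * w.1)
      fun w => zeroFactor (compensatingZero z₀ a b) w.1 w.2 := by
  obtain ⟨hj, hx⟩ := eq_and_exponents_of_pole_mul_pole_eq_one hR hz₀ hab
  have hy0 : ∀ w ∈ openAnnulus σ ×ˢ U, w.1 ≠ 0 := fun w hw =>
    norm_pos_iff.1 (hσ.trans hw.1.1)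
  have hy : DifferentiableOn ℂ (fun w : ℂ × Vars m => w.1) (openAnnulus σ ×ˢ U) :=
    differentiableOn_fst
  have hyi : DifferentiableOn ℂ (fun w : ℂ × Vars m => w.1⁻¹) (openAnnulus σ ×ˢ U) :=
    hy.fun_inv hy0
  have hc : ((poleSign z₀ a b : ℤ) : ℂ) ^ 2 = 1 := by
    rcases Int.units_eq_one_or (poleSign z₀ a b) with h | h <;> simp [h]
  have hp : ∀ c, DifferentiableOn ℂ (fun w : ℂ × Vars m => pole w.2 c) (openAnnulus σ ×ˢ U) :=
    fun c => (differentiableOn_pole hR hU c).comp differentiableOn_snd fun w hw => hw.2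
  have hs : DifferentiableOn ℂ (fun w : ℂ × Vars m => poleRoot w.2 a b) (openAnnulus σ ×ˢ U) :=
    (differentiableOn_poleRoot hR hU a b).comp differentiableOn_snd fun w hw => hw.2
  have hr : ∀ i j : ℕ, DifferentiableOn ℂ
      (fun w : ℂ × Vars m => w.2.2.2.1 ^ i * w.2.2.2.2.1 ^ j) (openAnnulus σ ×ˢ U) := fun i j => by
    fun_prop
  have hmul : ∀ z : Vars m, pole z a * pole z b = poleRoot z a b ^ 2 := fun z => pole_mul_pole z hj
  obtain ⟨j, μ, ν⟩ := a
  obtain ⟨j', μ', ν'⟩ := b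
  dsimp only at hj hx
  subst hj
  have key1 : ∀ k l : ℕ, μ' = μ + k → ν' = ν + l → HolComb (openAnnulus σ ×ˢ U)
      (fun w => 1 - pole w.2 (j, μ, ν) * w.1⁻¹) (fun w => 1 - pole w.2 (j, μ', ν') * w.1)
      fun w => zeroFactor (1, poleSign z₀ (j, μ, ν) (j, μ', ν'), (k, l)) w.1 w.2 := by
    intro k l hk hl
    have h := holComb_of_sq hc (hp (j, μ', ν')) hy hs (hr k l) hy0 (fun w hw => hpin w.2 hw.2)
      (fun w _ => hmul w.2) fun w _ => by
        simp only [pole, poleRoot, baseP, baseQ, hk, hl]; ring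
    simpa only [zeroFactor, Units.val_one, zpow_one] using h
  -- The same with the two poles interchanged and `Y = y⁻¹`, so that `r` again has nonnegative
  -- exponents.
  have key2 : ∀ k l : ℕ, μ = μ' + k → ν = ν' + l → HolComb (openAnnulus σ ×ˢ U)
      (fun w => 1 - pole w.2 (j, μ, ν) * w.1⁻¹) (fun w => 1 - pole w.2 (j, μ', ν') * w.1)
      fun w => zeroFactor (-1, poleSign z₀ (j, μ, ν) (j, μ', ν'), (k, l)) w.1 w.2 := by
    intro k l hk hl
    have h := holComb_of_sq hc (hp (j, μ, ν)) hyi hs (hr k l) (fun w hw => inv_ne_zero (hy0 w hw))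
      (fun w hw => hpin w.2 hw.2) (fun w _ => (mul_comm _ _).trans (hmul w.2)) fun w _ => by
        simp only [pole, poleRoot, baseP, baseQ, hk, hl]; ring
    simpa only [zeroFactor, Units.val_neg, Units.val_one, zpow_neg, zpow_one, inv_inv] using h.symm
  simp only [compensatingZero]
  split_ifs with h1 h2 h2
  · exact key1 _ _ (by omega) (by omega)
  · exact key2 _ _ (by omega) (by omega)
  · exact key1 _ _ (by omega) (by omega)
  · exact key2 _ _ (by omega) (by omega)

/-- Pairs unpinched at `z₀` contribute the factor `1`, pinched pairs their compensating zero. By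
injectivity the product over all pairs is a product of distinct zero factors, hence divides the
numerator. -/
theorem holComb_zeroProduct (hR : 0 < R) (hσ : 0 < σ) (hU : U ⊆ continuationDomain m R)
    {z₀ : Vars m} (hz₀ : z₀ ∈ continuationDomain m R) (N : ℕ)
    (hunp : ∀ z ∈ U, ∀ a ∈ poleBox m N, ∀ b ∈ poleBox m N, pole z₀ a * pole z₀ b ≠ 1 →
      pole z a * pole z b ≠ 1)
    (hpin : ∀ z ∈ U, ∀ a ∈ poleBox m N, ∀ b ∈ poleBox m N, pole z₀ a * pole z₀ b = 1 →
      poleRoot z a b + ((poleSign z₀ a b : ℤ) : ℂ) ≠ 0) :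
    HolComb (openAnnulus σ ×ˢ U) (fun w => ∏ a ∈ poleBox m N, (1 - pole w.2 a * w.1⁻¹))
      (fun w => ∏ b ∈ poleBox m N, (1 - pole w.2 b * w.1)) fun w => zeroProduct N w.1 w.2 := by
  classical
  have hy0 : ∀ w ∈ openAnnulus σ ×ˢ U, w.1 ≠ 0 := fun w hw =>
    norm_pos_iff.1 (hσ.trans hw.1.1)
  have hy : DifferentiableOn ℂ (fun w : ℂ × Vars m => w.1) (openAnnulus σ ×ˢ U) :=
    differentiableOn_fst
  have hyi : DifferentiableOn ℂ (fun w : ℂ × Vars m => w.1⁻¹) (openAnnulus σ ×ˢ U) :=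
    hy.fun_inv hy0
  have hp : ∀ c, DifferentiableOn ℂ (fun w : ℂ × Vars m => pole w.2 c) (openAnnulus σ ×ˢ U) :=
    fun c => (differentiableOn_pole hR hU c).comp differentiableOn_snd fun w hw => hw.2
  have h1 := HolComb.prod_prod (Ω := openAnnulus σ ×ˢ U) (poleBox m N) (poleBox m N)
    (P := fun a w => 1 - pole w.2 a * w.1⁻¹) (Q := fun b w => 1 - pole w.2 b * w.1)
    (N := fun a b w => if pole z₀ a * pole z₀ b = 1 then
      zeroFactor (compensatingZero z₀ a b) w.1 w.2 else 1)
    (fun a _ => ((hp a).mul hyi).const_sub 1) (fun b _ => ((hp b).mul hy).const_sub 1)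
    fun a ha b hb => by
      by_cases hab : pole z₀ a * pole z₀ b = 1
      · simp only [hab, if_true]
        exact holComb_zeroFactor hR hσ hU hz₀ hab fun z hz => hpin z hz a ha b hb hab
      · simp only [hab, if_false]
        exact holComb_one (hp a) (hp b) hy hy0 fun w hw => hunp w.2 hw.2 a ha b hb hab
  let pairs := {x ∈ poleBox m N ×ˢ poleBox m N | pole z₀ x.1 * pole z₀ x.2 = 1}
  let img := pairs.image fun x => compensatingZero z₀ x.1 x.2
  have himg : img ⊆ (Finset.univ : Finset ℤˣ) ×ˢ ((Finset.univ : Finset ℤˣ) ×ˢ axisBox N) := by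
    intro f hf
    obtain ⟨x, hx, rfl⟩ := Finset.mem_image.1 hf
    have hx := Finset.mem_product.1 (Finset.mem_filter.1 hx).1
    exact compensatingZero_mem z₀ hx.1 hx.2
  have h2 : ∀ w : ℂ × Vars m, (∏ a ∈ poleBox m N, ∏ b ∈ poleBox m N,
      if pole z₀ a * pole z₀ b = 1 then zeroFactor (compensatingZero z₀ a b) w.1 w.2 else 1) =
      ∏ f ∈ img, zeroFactor f w.1 w.2 := by
    intro w
    rw [Finset.prod_image, Finset.prod_filter, Finset.prod_product]
    exact (injOn_compensatingZero hR hz₀).mono fun x hx => (Finset.mem_filter.1 hx).2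
  simp only [h2] at h1
  have hf : ∀ f, DifferentiableOn ℂ (fun w : ℂ × Vars m => zeroFactor f w.1 w.2)
      (openAnnulus σ ×ˢ U) := by
    intro f
    have hz : DifferentiableOn ℂ (fun w : ℂ × Vars m => w.1 ^ (f.1 : ℤ)) (openAnnulus σ ×ˢ U) := by
      rcases Int.units_eq_one_or f.1 with h | h
      · simpa [h] using hy
      · simpa [h] using hyi
    unfold zeroFactor
    exact (DifferentiableOn.mul (by fun_prop) hz).const_sub 1
  -- The zeros not used by any pair are put back as a holomorphic multiplier.
  have h3 := h1.mul_left (DifferentiableOn.finset_prod_of_normed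
    (((Finset.univ : Finset ℤˣ) ×ˢ ((Finset.univ : Finset ℤˣ) ×ˢ axisBox N)) \ img)
    fun f _ => hf f)
  simpa only [Finset.prod_sdiff himg, zeroProduct] using h3

/-- Near every point of the continuation domain, the one-variable weight is the sum of a function
without inner poles and a function without outer poles, depending holomorphically on parameters. -/
theorem exists_local_decomposition (hR : 0 < R) {z₀ : Vars m} (hz₀ : z₀ ∈ continuationDomain m R) :
    ∃ (σ : ℝ) (U : Set (Vars m)) (f₁ f₂ : ℂ × Vars m → ℂ), 0 < σ ∧ σ < R ∧ IsOpen U ∧ z₀ ∈ U ∧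
      U ⊆ continuationDomain m R ∧ (∀ z ∈ U, ‖baseT z‖ < σ ^ 2) ∧
      DifferentiableOn ℂ f₁ {w | w.1 ∈ openAnnulus σ ∧ w.2 ∈ U ∧ w.1 ∉ outerPoles w.2} ∧
      DifferentiableOn ℂ f₂ {w | w.1 ∈ openAnnulus σ ∧ w.2 ∈ U ∧ w.1 ∉ innerPoles w.2} ∧
      ∀ y ∈ openAnnulus σ, ∀ z ∈ U, y ∉ outerPoles z → y ∉ innerPoles z →
        f₁ (y, z) + f₂ (y, z) = oneVarWeight y z := by
  obtain ⟨hb, ht, -⟩ := (mem_continuationDomain_iff hR).1 hz₀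
  -- `σ² > |t|` keeps the poles of `Γ(t y_k^± y_l^±)` out of the annuli, and `σ < R` leaves room for
  -- both circles.
  obtain ⟨σ, hσ1, hσR⟩ := exists_between (show Real.sqrt ‖baseT z₀‖ < R from
    (Real.sqrt_lt' hR).2 ht)
  have hσ : 0 < σ := (Real.sqrt_nonneg _).trans_lt hσ1
  have htσ : ‖baseT z₀‖ < σ ^ 2 := (Real.sqrt_lt' hσ).1 hσ1
  obtain ⟨ρ, hρ, hρ1⟩ := exists_between (max_lt hb.2.2.2.2.2.1 hb.2.2.2.2.2.2)
  have hρ0 : 0 ≤ ρ := (norm_nonneg _).trans ((le_max_left _ _).trans hρ.le)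
  obtain ⟨N, hN⟩ := exists_pow_lt_of_lt_one (show 0 < σ ^ 2 by positivity) hρ1
  have hD := (isOpen_continuationDomain (m := m) hR).mem_nhds hz₀
  have hpc : ∀ a, ContinuousAt (fun z : Vars m => pole z a) z₀ := fun a =>
    (differentiableOn_pole hR Subset.rfl a).continuousOn.continuousAt hD
  have hrc : ∀ a b, ContinuousAt (fun z : Vars m => poleRoot z a b) z₀ := fun a b =>
    (differentiableOn_poleRoot hR Subset.rfl a b).continuousOn.continuousAt hD
  have e1 : ∀ᶠ z in 𝓝 z₀, ∀ a ∈ poleBox m N, ∀ b ∈ poleBox m N, pole z₀ a * pole z₀ b ≠ 1 →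
      pole z a * pole z b ≠ 1 := by
    refine (Finset.eventually_all _).2 fun a _ => (Finset.eventually_all _).2 fun b _ => ?_
    by_cases h : pole z₀ a * pole z₀ b = 1
    · exact Eventually.of_forall fun z h' => absurd h h'
    · filter_upwards [((hpc a).mul (hpc b)).eventually_ne h] with z hz _ using hz
  have e2 : ∀ᶠ z in 𝓝 z₀, ∀ a ∈ poleBox m N, ∀ b ∈ poleBox m N, pole z₀ a * pole z₀ b = 1 →
      poleRoot z a b + ((poleSign z₀ a b : ℤ) : ℂ) ≠ 0 := by
    refine (Finset.eventually_all _).2 fun a _ => (Finset.eventually_all _).2 fun b _ => ?_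
    by_cases h : pole z₀ a * pole z₀ b = 1
    · have hj := (eq_and_exponents_of_pole_mul_pole_eq_one hR hz₀ h).1
      -- At `z₀` the root equals its sign, so the sum is `±2`.
      have hne : poleRoot z₀ a b + ((poleSign z₀ a b : ℤ) : ℂ) ≠ 0 := by
        rw [← poleSign_eq hj h, ← two_mul]
        rcases Int.units_eq_one_or (poleSign z₀ a b) with h | h <;> simp [h]
      filter_upwards [((hrc a b).add continuousAt_const).eventually_ne hne] with z hz _ using hz
    · exact Eventually.of_forall fun z h' => absurd h' h
  have e3 : ∀ᶠ z in 𝓝 z₀, ‖baseT z‖ < σ ^ 2 :=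
    (differentiable_baseT (m := m)).continuous.continuousAt.norm.eventually_lt
      continuousAt_const htσ
  have e4 : ∀ᶠ z in 𝓝 z₀, ‖baseP z‖ < ρ :=
    (differentiable_baseP (m := m)).continuous.continuousAt.norm.eventually_lt
      continuousAt_const ((le_max_left _ _).trans_lt hρ)
  have e5 : ∀ᶠ z in 𝓝 z₀, ‖baseQ z‖ < ρ :=
    (differentiable_baseQ (m := m)).continuous.continuousAt.norm.eventually_lt
      continuousAt_const ((le_max_right _ _).trans_lt hρ)
  obtain ⟨U, hU, hUo, hzU⟩ := _root_.eventually_nhds_iff.1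
    ((eventually_mem_set.2 hD).and (e1.and (e2.and (e3.and (e4.and e5)))))
  have hUD : U ⊆ continuationDomain m R := fun z hz => (hU z hz).1
  obtain ⟨A, B, hA, hB, hAB⟩ := holComb_zeroProduct hR hσ hUD hz₀ N
    (fun z hz => (hU z hz).2.1) (fun z hz => (hU z hz).2.2.1)
  have hE := differentiableOn_weightTail hσ hσR hR hρ1 hN hUD (fun z hz => (hU z hz).2.2.2.2.1)
    (fun z hz => (hU z hz).2.2.2.2.2)
  have hy0 : ∀ w ∈ openAnnulus σ ×ˢ U, w.1 ≠ 0 := fun w hw =>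
    norm_pos_iff.1 (hσ.trans hw.1.1)
  have hy : DifferentiableOn ℂ (fun w : ℂ × Vars m => w.1) (openAnnulus σ ×ˢ U) :=
    differentiableOn_fst
  have hyi : DifferentiableOn ℂ (fun w : ℂ × Vars m => w.1⁻¹) (openAnnulus σ ×ˢ U) :=
    hy.fun_inv hy0
  have hp : ∀ c, DifferentiableOn ℂ (fun w : ℂ × Vars m => pole w.2 c) (openAnnulus σ ×ˢ U) :=
    fun c => (differentiableOn_pole hR hUD c).comp differentiableOn_snd fun w hw => hw.2
  have hP : DifferentiableOn ℂ (fun w : ℂ × Vars m => ∏ a ∈ poleBox m N, (1 - pole w.2 a * w.1⁻¹))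
      (openAnnulus σ ×ˢ U) :=
    DifferentiableOn.finset_prod_of_normed _ fun a _ => ((hp a).mul hyi).const_sub 1
  have hQ : DifferentiableOn ℂ (fun w : ℂ × Vars m => ∏ a ∈ poleBox m N, (1 - pole w.2 a * w.1))
      (openAnnulus σ ×ˢ U) :=
    DifferentiableOn.finset_prod_of_normed _ fun a _ => ((hp a).mul hy).const_sub 1
  have hpq : ∀ z ∈ U, ‖baseP z‖ < 1 ∧ ‖baseQ z‖ < 1 := fun z hz =>
    ⟨(hU z hz).2.2.2.2.1.trans hρ1, (hU z hz).2.2.2.2.2.trans hρ1⟩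
  have hQ0 : ∀ y, ∀ z ∈ U, y ∉ outerPoles z → ∏ a ∈ poleBox m N, (1 - pole z a * y) ≠ 0 := by
    intro y z hz hy h
    refine hy ?_
    rw [outerPoles, mem_ofPred_eq, prod_pochOn_eq N y (hpq z hz).1 (hpq z hz).2, h, zero_mul]
  have hP0 : ∀ y, ∀ z ∈ U, y ∉ innerPoles z → ∏ a ∈ poleBox m N, (1 - pole z a * y⁻¹) ≠ 0 := by
    intro y z hz hy h
    refine hy ?_
    rw [innerPoles, mem_ofPred_eq, prod_pochOn_eq N y⁻¹ (hpq z hz).1 (hpq z hz).2, h, zero_mul]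
  -- Dividing `A P + B Q` by `P Q` leaves `A/Q`, with outer poles only, and `B/P`, with inner poles
  -- only.
  refine ⟨σ, U, fun w => A w * weightTail N w.1 w.2 *
      (∏ a ∈ poleBox m N, (1 - pole w.2 a * w.1))⁻¹,
    fun w => B w * weightTail N w.1 w.2 * (∏ a ∈ poleBox m N, (1 - pole w.2 a * w.1⁻¹))⁻¹,
    hσ, hσR, hUo, hzU, hUD, fun z hz => (hU z hz).2.2.2.1, ?_, ?_, ?_⟩
  · have hsub : {w : ℂ × Vars m | w.1 ∈ openAnnulus σ ∧ w.2 ∈ U ∧ w.1 ∉ outerPoles w.2} ⊆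
      openAnnulus σ ×ˢ U := fun w hw => ⟨hw.1, hw.2.1⟩
    exact ((hA.mul hE).mono hsub).mul
      ((hQ.mono hsub).fun_inv fun w hw => hQ0 w.1 w.2 hw.2.1 hw.2.2)
  · have hsub : {w : ℂ × Vars m | w.1 ∈ openAnnulus σ ∧ w.2 ∈ U ∧ w.1 ∉ innerPoles w.2} ⊆
      openAnnulus σ ×ˢ U := fun w hw => ⟨hw.1, hw.2.1⟩
    exact ((hB.mul hE).mono hsub).mul
      ((hP.mono hsub).fun_inv fun w hw => hP0 w.1 w.2 hw.2.1 hw.2.2)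
  · intro y hyA z hz ho hi
    have h1 := hQ0 y z hz ho
    have h2 := hP0 y z hz hi
    have h3 := hAB (y, z) ⟨hyA, hz⟩
    dsimp only at h3 ⊢
    rw [oneVarWeight_eq N y (hpq z hz).1 (hpq z hz).2, h3]
    generalize ∏ a ∈ poleBox m N, (1 - pole z a * y) = Q at h1 ⊢
    generalize ∏ a ∈ poleBox m N, (1 - pole z a * y⁻¹) = P at h2 ⊢
    field_simp

end LocalDecompositionExistence

end VanDiejen

namespace VanDiejen

/-! ### Factorization of the integrand and location of its poles. -/

noncomputable section Continuation

variable {m n : ℕ}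

/-- The factor of the integrand which is holomorphic in a product of annuli. -/
def regularFactor (φ : (Fin n → ℂ) → ℂ) (y : Fin n → ℂ) (z : Vars m) : ℂ :=
  (∏ k, y k)⁻¹ * φ y * ∏ k, ∏ l ∈ Finset.Ioi k,
    ellGammaPMPM (baseT z) (y k) (y l) (baseP z) (baseQ z) *
      (thetaPair (y k * y l) (baseP z) (baseQ z) * thetaPair (y k * (y l)⁻¹) (baseP z) (baseQ z))

theorem inv_ellGammaPM_one {y p q : ℂ} (hy : ‖y‖ = 1) (hp : ‖p‖ < 1) (hq : ‖q‖ < 1) :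
    (ellGammaPM 1 y p q)⁻¹ = thetaPair y p q := by
  rw [ellGammaPM, one_mul, one_mul, inv_ellGamma_mul_ellGamma_inv hy hp hq]

theorem inv_ellGammaPMPM_one {x y p q : ℂ} (hx : ‖x‖ = 1) (hy : ‖y‖ = 1) (hp : ‖p‖ < 1)
    (hq : ‖q‖ < 1) :
    (ellGammaPMPM 1 x y p q)⁻¹ = thetaPair (x * y) p q * thetaPair (x * y⁻¹) p q := by
  rw [← inv_ellGamma_mul_ellGamma_inv (z := x * y) (by simp [hx, hy]) hp hq,
    ← inv_ellGamma_mul_ellGamma_inv (z := x * y⁻¹) (by simp [hx, hy]) hp hq, ← mul_inv]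
  simp only [ellGammaPMPM, ellGammaPM, one_mul, mul_inv, inv_inv]
  ring

/-- On the torus the quotients by `Γ` become theta factors, which make sense on whole annuli. The
kernel and the parameters `b_s` merge into a single product over the `c_j`. -/
theorem integrand_eq {φ : (Fin n → ℂ) → ℂ} {x : Fin m → ℂ} {a : Fin 8 → ℂ} {u v τ : ℂ}
    (hp : ‖u ^ 2‖ < 1) (hq : ‖v ^ 2‖ < 1) {y : Fin n → ℂ} (hy : ∀ k, ‖y k‖ = 1) :
    integrand φ x a u v τ y = (∏ k, oneVarWeight (y k) ((x, a, u, v, τ) : Vars m)) *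
      regularFactor φ y ((x, a, u, v, τ) : Vars m) := by
  have h1 : ∀ k, oneVarWeight (y k) ((x, a, u, v, τ) : Vars m) =
      ((∏ s, ellGammaPM (dualParams a u v τ s) (y k) (u ^ 2) (v ^ 2)) /
        ellGammaPM 1 (y k ^ 2) (u ^ 2) (v ^ 2)) *
        ∏ i, ellGammaPMPM (u * v * τ⁻¹) (x i) (y k) (u ^ 2) (v ^ 2) := by
    intro k
    rw [div_eq_mul_inv, inv_ellGammaPM_one (by simp [hy k]) hp hq, oneVarWeight,
      Fintype.prod_sum_type, Fintype.prod_prod_type]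
    simp only [prod_units_int, kernelParam, Units.val_one, Units.val_neg, zpow_one, zpow_neg,
      ellGammaPM, ellGammaPMPM, baseP, baseQ]
    ring
  have h2 : ∀ k l, ellGammaPMPM (τ ^ 2) (y k) (y l) (u ^ 2) (v ^ 2) /
      ellGammaPMPM 1 (y k) (y l) (u ^ 2) (v ^ 2) =
      ellGammaPMPM (τ ^ 2) (y k) (y l) (u ^ 2) (v ^ 2) *
      (thetaPair (y k * y l) (u ^ 2) (v ^ 2) * thetaPair (y k * (y l)⁻¹) (u ^ 2) (v ^ 2)) :=
    fun k l => by rw [div_eq_mul_inv, inv_ellGammaPMPM_one (hy k) (hy l) hp hq]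
  simp only [integrand, weight, cauchyKernel, h1, h2, regularFactor, baseP, baseQ, baseT,
    Finset.prod_mul_distrib]
  rw [Finset.prod_comm (s := (Finset.univ : Finset (Fin m)))]
  ring

theorem differentiableOn_ellGamma {E : Type*} [NormedAddCommGroup E] [NormedSpace ℂ E]
    {a p q : E → ℂ} {s : Set E} (ha : DifferentiableOn ℂ a s)
    (hp : DifferentiableOn ℂ p s) (hq : DifferentiableOn ℂ q s) (hp1 : ∀ z ∈ s, ‖p z‖ < 1)
    (hq1 : ∀ z ∈ s, ‖q z‖ < 1) (ha0 : ∀ z ∈ s, a z ≠ 0) (ha1 : ∀ z ∈ s, ‖a z‖ < 1) :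
    DifferentiableOn ℂ (fun z => ellGamma (a z) (p z) (q z)) s := by
  simp only [ellGamma, pochhammer_eq_pochOn_univ, div_eq_mul_inv]
  refine DifferentiableOn.mul ?_ (DifferentiableOn.fun_inv ?_ fun z hz => ?_)
  · exact DifferentiableOn.pochOn _ ((hp.mul hq).mul (ha.fun_inv ha0)) hp hq hp1 hq1
  · exact DifferentiableOn.pochOn _ ha hp hq hp1 hq1
  · exact pochOn_ne_zero_of_norm_lt_one _ (ha1 z hz) (hp1 z hz) (hq1 z hz)

theorem differentiableOn_thetaPair {E : Type*} [NormedAddCommGroup E] [NormedSpace ℂ E]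
    {a p q : E → ℂ} {s : Set E} (ha : DifferentiableOn ℂ a s)
    (hp : DifferentiableOn ℂ p s) (hq : DifferentiableOn ℂ q s) (hp1 : ∀ z ∈ s, ‖p z‖ < 1)
    (hq1 : ∀ z ∈ s, ‖q z‖ < 1) (ha0 : ∀ z ∈ s, a z ≠ 0) :
    DifferentiableOn ℂ (fun z => thetaPair (a z) (p z) (q z)) s := by
  unfold thetaPair
  have hai := ha.fun_inv ha0
  exact ((DifferentiableOn.pochOn _ ha hp hq hp1 hq1).mul
    (DifferentiableOn.pochOn _ hai hp hq hp1 hq1)).mul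
    ((DifferentiableOn.pochOn _ ha hp hq hp1 hq1).mul
      (DifferentiableOn.pochOn _ hai hp hq hp1 hq1))

/-- All arguments satisfy `|t y_k^± y_l^±| < σ² σ⁻² = 1`, so the interaction has no poles; the theta
factors are holomorphic on `ℂ*`. -/
theorem differentiableOn_regularFactor {φ : (Fin n → ℂ) → ℂ}
    (hφ : DifferentiableOn ℂ φ {y | ∀ k, y k ≠ 0}) {σ : ℝ} (hσ : 0 < σ) {U : Set (Vars m)}
    (hU : U ⊆ baseRegion m) (ht : ∀ z ∈ U, ‖baseT z‖ < σ ^ 2) :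
    DifferentiableOn ℂ (fun w : (Fin n → ℂ) × Vars m => regularFactor φ w.1 w.2)
      ({y | ∀ k, y k ∈ openAnnulus σ} ×ˢ U) := by
  set Ω : Set ((Fin n → ℂ) × Vars m) := {y | ∀ k, y k ∈ openAnnulus σ} ×ˢ U
  have hy : ∀ k, DifferentiableOn ℂ (fun w : (Fin n → ℂ) × Vars m => w.1 k) Ω := fun k => by
    fun_prop
  have hy0 : ∀ k, ∀ w ∈ Ω, w.1 k ≠ 0 := fun k w hw => norm_pos_iff.1 (hσ.trans (hw.1 k).1)
  have hyi : ∀ k, DifferentiableOn ℂ (fun w : (Fin n → ℂ) × Vars m => (w.1 k)⁻¹) Ω := fun k =>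
    (hy k).fun_inv (hy0 k)
  have hyn : ∀ k, ∀ w ∈ Ω, ‖w.1 k‖ < σ⁻¹ ∧ ‖(w.1 k)⁻¹‖ < σ⁻¹ := fun k w hw =>
    ⟨(hw.1 k).2, by rw [norm_inv]; exact inv_strictAnti₀ hσ (hw.1 k).1⟩
  have hp : DifferentiableOn ℂ (fun w : (Fin n → ℂ) × Vars m => baseP w.2) Ω :=
    (differentiable_baseP.comp differentiable_snd).differentiableOn
  have hq : DifferentiableOn ℂ (fun w : (Fin n → ℂ) × Vars m => baseQ w.2) Ω :=
    (differentiable_baseQ.comp differentiable_snd).differentiableOn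
  have htd : DifferentiableOn ℂ (fun w : (Fin n → ℂ) × Vars m => baseT w.2) Ω :=
    (differentiable_baseT.comp differentiable_snd).differentiableOn
  have hp1 : ∀ w ∈ Ω, ‖baseP w.2‖ < 1 := fun w hw => (hU hw.2).2.2.2.2.2.1
  have hq1 : ∀ w ∈ Ω, ‖baseQ w.2‖ < 1 := fun w hw => (hU hw.2).2.2.2.2.2.2
  have ht0 : ∀ w ∈ Ω, baseT w.2 ≠ 0 := fun w hw => pow_ne_zero _ (hU hw.2).2.2.1
  have hG : ∀ {a b : (Fin n → ℂ) × Vars m → ℂ}, DifferentiableOn ℂ a Ω → DifferentiableOn ℂ b Ω →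
      (∀ w ∈ Ω, a w ≠ 0 ∧ ‖a w‖ < σ⁻¹) → (∀ w ∈ Ω, b w ≠ 0 ∧ ‖b w‖ < σ⁻¹) →
      DifferentiableOn ℂ (fun w => ellGamma (baseT w.2 * a w * b w) (baseP w.2) (baseQ w.2)) Ω := by
    intro a b ha hb ha1 hb1
    refine differentiableOn_ellGamma ((htd.mul ha).mul hb) hp hq hp1 hq1
      (fun w hw => mul_ne_zero (mul_ne_zero (ht0 w hw) (ha1 w hw).1) (hb1 w hw).1) fun w hw => ?_
    rw [norm_mul, norm_mul]
    have h1 := ht w.2 hw.2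
    calc ‖baseT w.2‖ * ‖a w‖ * ‖b w‖ ≤ ‖baseT w.2‖ * σ⁻¹ * σ⁻¹ := by
          gcongr
          · exact (ha1 w hw).2.le
          · exact (hb1 w hw).2.le
      _ < σ ^ 2 * σ⁻¹ * σ⁻¹ := by gcongr
      _ = 1 := by field_simp
  have hyp : ∀ k, ∀ w ∈ Ω, w.1 k ≠ 0 ∧ ‖w.1 k‖ < σ⁻¹ := fun k w hw => ⟨hy0 k w hw, (hyn k w hw).1⟩
  have hyip : ∀ k, ∀ w ∈ Ω, (w.1 k)⁻¹ ≠ 0 ∧ ‖(w.1 k)⁻¹‖ < σ⁻¹ := fun k w hw =>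
    ⟨inv_ne_zero (hy0 k w hw), (hyn k w hw).2⟩
  unfold regularFactor
  refine DifferentiableOn.mul (DifferentiableOn.mul ?_ ?_) ?_
  · exact (DifferentiableOn.finset_prod_of_normed _ fun k _ => hy k).fun_inv fun w hw =>
      Finset.prod_ne_zero_iff.2 fun k _ => hy0 k w hw
  · exact hφ.comp differentiableOn_fst fun w hw k => hy0 k w hw
  · refine DifferentiableOn.finset_prod_of_normed _ fun k _ =>
      DifferentiableOn.finset_prod_of_normed _ fun l _ => DifferentiableOn.mul ?_ ?_
    · unfold ellGammaPMPM ellGammaPM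
      exact ((hG (hy k) (hy l) (hyp k) (hyp l)).mul (hG (hy k) (hyi l) (hyp k) (hyip l))).mul
        ((hG (hyi k) (hy l) (hyip k) (hyp l)).mul (hG (hyi k) (hyi l) (hyip k) (hyip l)))
    · exact (differentiableOn_thetaPair ((hy k).mul (hy l)) hp hq hp1 hq1 fun w hw =>
        mul_ne_zero (hy0 k w hw) (hy0 l w hw)).mul
        (differentiableOn_thetaPair ((hy k).mul (hyi l)) hp hq hp1 hq1 fun w hw =>
          mul_ne_zero (hy0 k w hw) (inv_ne_zero (hy0 l w hw)))

theorem exists_mul_eq_one_of_mem_outerPoles {z : Vars m} (hz : z ∈ baseRegion m) {y : ℂ}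
    (hy : y ∈ outerPoles z) :
    ∃ j, ∃ ij : ℕ × ℕ, kernelParam z j * y * baseP z ^ ij.1 * baseQ z ^ ij.2 = 1 := by
  obtain ⟨j, -, hj⟩ := Finset.prod_eq_zero_iff.1 hy
  by_contra! h
  exact (pochOn_ne_zero_iff hz.2.2.2.2.2.1 hz.2.2.2.2.2.2).2 (fun ij _ => h j ij) hj

theorem exists_mul_eq_one_of_mem_innerPoles {z : Vars m} (hz : z ∈ baseRegion m) {y : ℂ}
    (hy : y ∈ innerPoles z) :
    ∃ j, ∃ ij : ℕ × ℕ, kernelParam z j * y⁻¹ * baseP z ^ ij.1 * baseQ z ^ ij.2 = 1 := by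
  obtain ⟨j, -, hj⟩ := Finset.prod_eq_zero_iff.1 hy
  by_contra! h
  exact (pochOn_ne_zero_iff hz.2.2.2.2.2.1 hz.2.2.2.2.2.2).2 (fun ij _ => h j ij) hj

theorem lt_norm_of_mem_outerPoles {z : Vars m} (hz : z ∈ baseRegion m) {r : ℝ}
    (hc : ∀ j, ‖kernelParam z j‖ * r < 1) {y : ℂ} (hy : y ∈ outerPoles z) : r < ‖y‖ := by
  obtain ⟨j, ij, h⟩ := exists_mul_eq_one_of_mem_outerPoles hz hy
  by_contra! hle
  have h1 : ‖kernelParam z j * y‖ < 1 := by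
    rw [norm_mul]
    exact (mul_le_mul_of_nonneg_left hle (norm_nonneg _)).trans_lt (hc j)
  have := norm_mul_pow_mul_pow_lt_one h1 hz.2.2.2.2.2.1 hz.2.2.2.2.2.2 ij.1 ij.2
  rw [h, norm_one] at this
  exact lt_irrefl _ this

theorem norm_lt_of_mem_innerPoles {z : Vars m} (hz : z ∈ baseRegion m) {r : ℝ} (hr : 0 < r)
    (hc : ∀ j, ‖kernelParam z j‖ * r < 1) {y : ℂ} (hy : y ∈ innerPoles z) : ‖y‖ < r⁻¹ := by
  obtain ⟨j, ij, h⟩ := exists_mul_eq_one_of_mem_innerPoles hz hy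
  by_contra! hle
  have h1 : ‖kernelParam z j * y⁻¹‖ < 1 := by
    rw [norm_mul, norm_inv]
    refine (mul_le_mul_of_nonneg_left ?_ (norm_nonneg _)).trans_lt (hc j)
    exact inv_le_of_inv_le₀ hr hle
  have := norm_mul_pow_mul_pow_lt_one h1 hz.2.2.2.2.2.1 hz.2.2.2.2.2.2 ij.1 ij.2
  rw [h, norm_one] at this
  exact lt_irrefl _ this

/-- At a common point the two pole equations multiply to `c_j c_k p^μ q^ν = 1`, since `y` cancels.
-/
theorem disjoint_outerPoles_innerPoles {z : Vars m} (hz : z ∈ baseRegion m)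
    (hu : z ∈ unpinched m) : Disjoint (outerPoles z) (innerPoles z) := by
  rw [disjoint_left]
  intro y ho hi
  obtain ⟨j, ij, h⟩ := exists_mul_eq_one_of_mem_outerPoles hz ho
  obtain ⟨k, kl, h'⟩ := exists_mul_eq_one_of_mem_innerPoles hz hi
  have hy : y ≠ 0 := fun h0 => by simp [h0] at h
  refine (pochOn_ne_zero_iff hz.2.2.2.2.2.1 hz.2.2.2.2.2.2).1 (hu j k) (ij + kl) (mem_univ _) ?_
  have h2 : y * y⁻¹ = 1 := mul_inv_cancel₀ hy
  have h3 : (kernelParam z j * y * baseP z ^ ij.1 * baseQ z ^ ij.2) *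
    (kernelParam z k * y⁻¹ * baseP z ^ kl.1 * baseQ z ^ kl.2) = 1 := by rw [h, h', one_mul]
  simp only [Prod.fst_add, Prod.snd_add, pow_add]
  linear_combination h3 - kernelParam z j * kernelParam z k * baseP z ^ ij.1 * baseP z ^ kl.1 *
    baseQ z ^ ij.2 * baseQ z ^ kl.2 * h2

theorem isClosed_outerPoles {z : Vars m} (hz : z ∈ baseRegion m) : IsClosed (outerPoles z) := by
  refine isClosed_eq ?_ continuous_const
  rw [← continuousOn_univ]
  exact continuousOn_finsetProd _ fun j _ => ContinuousOn.pochOn _ (by fun_prop) (by fun_prop)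
    (by fun_prop) (fun _ _ => hz.2.2.2.2.2.1) fun _ _ => hz.2.2.2.2.2.2

theorem isOpen_openAnnulus_sdiff_innerPoles {z : Vars m} (hz : z ∈ baseRegion m) {σ : ℝ}
    (hσ : 0 < σ) : IsOpen (openAnnulus σ \ innerPoles z) := by
  have hc : ContinuousOn (fun y : ℂ =>
      ∏ j, pochOn univ (kernelParam z j * y⁻¹) (baseP z) (baseQ z)) (openAnnulus σ) :=
    continuousOn_finsetProd _ fun j _ => ContinuousOn.pochOn _
      (continuousOn_const.mul (continuousOn_id.inv₀ fun y hy => norm_pos_iff.1 (hσ.trans hy.1)))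
      continuousOn_const continuousOn_const (fun _ _ => hz.2.2.2.2.2.1)
      fun _ _ => hz.2.2.2.2.2.2
  have := hc.isOpen_inter_preimage (isOpen_openAnnulus σ) isOpen_ne (t := {x | x ≠ (0 : ℂ)})
  exact this

end Continuation

end VanDiejen

namespace VanDiejen

/-! ### Gluing the local continuations. -/

noncomputable section Gluing

variable {m n : ℕ}

/-- `f₁ + f₂` decomposes the one-variable weight at `z` in an annulus, where `f₁` is holomorphic
away from the outer poles and `f₂` is holomorphic away from the inner poles. -/
structure IsSplitting (σ : ℝ) (z : Vars m) (f₁ f₂ : ℂ → ℂ) : Prop where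
  pos : 0 < σ
  norm_baseT_lt : ‖baseT z‖ < σ ^ 2
  left : DifferentiableOn ℂ f₁ (openAnnulus σ \ outerPoles z)
  right : DifferentiableOn ℂ f₂ (openAnnulus σ \ innerPoles z)
  add_eq : ∀ y ∈ openAnnulus σ, y ∉ outerPoles z → y ∉ innerPoles z →
    f₁ y + f₂ y = oneVarWeight y z

theorem openAnnulus_anti {σ σ' : ℝ} (hσ : 0 < σ) (h : σ ≤ σ') :
    openAnnulus σ' ⊆ openAnnulus σ := fun _ hy =>
  ⟨h.trans_lt hy.1, hy.2.trans_le (inv_anti₀ hσ h)⟩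

theorem IsSplitting.mono {σ σ' : ℝ} {z : Vars m} {f₁ f₂ : ℂ → ℂ} (hf : IsSplitting σ z f₁ f₂)
    (h : σ ≤ σ') : IsSplitting σ' z f₁ f₂ where
  pos := hf.pos.trans_le h
  norm_baseT_lt := hf.norm_baseT_lt.trans_le (pow_le_pow_left₀ hf.pos.le h 2)
  left := hf.left.mono (sdiff_subset_sdiff_left (openAnnulus_anti hf.pos h))
  right := hf.right.mono (sdiff_subset_sdiff_left (openAnnulus_anti hf.pos h))
  add_eq := fun y hy => hf.add_eq y (openAnnulus_anti hf.pos h hy)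

theorem IsSplitting.differentiableOn_regularFactor {σ : ℝ} {z : Vars m} {f₁ f₂ : ℂ → ℂ}
    (hf : IsSplitting σ z f₁ f₂) (hz : z ∈ baseRegion m) {φ : (Fin n → ℂ) → ℂ}
    (hφ : DifferentiableOn ℂ φ {y | ∀ k, y k ≠ 0}) :
    DifferentiableOn ℂ (fun y => regularFactor φ y z) {y | ∀ k, y k ∈ openAnnulus σ} :=
  (VanDiejen.differentiableOn_regularFactor hφ hf.pos (singleton_subset_iff.2 hz)
    fun _ hw => hw ▸ hf.norm_baseT_lt).comp (f := fun y : Fin n → ℂ => (y, z))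
    (by fun_prop) fun _ hy => ⟨hy, rfl⟩

/-- `w` is the value at `z` of the integral over deformed contours, computed by means of some
splitting of the one-variable weight. -/
def IsContinuationValue (φ : (Fin n → ℂ) → ℂ) (R : ℝ) (z : Vars m) (w : ℂ) : Prop :=
  ∃ (σ : ℝ) (f₁ f₂ : ℂ → ℂ), σ < R ∧ IsSplitting σ z f₁ f₂ ∧
    w = ((2 * (Real.pi : ℂ) * Complex.I) ^ n)⁻¹ *
      iterSplitIntegral R R⁻¹ f₁ f₂ n fun y => regularFactor φ y z

variable {R : ℝ} {φ : (Fin n → ℂ) → ℂ}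

theorem sphere_subset_openAnnulus_of_lt (hR1 : R ≤ 1) {σ : ℝ} (hσ : 0 < σ) (hσR : σ < R) :
    sphere (0 : ℂ) R ⊆ openAnnulus σ ∧ sphere (0 : ℂ) R⁻¹ ⊆ openAnnulus σ ∧
      sphere (0 : ℂ) 1 ⊆ openAnnulus σ := by
  have hR : 0 < R := hσ.trans hσR
  have h1 : 1 ≤ R⁻¹ := (one_le_inv₀ hR).2 hR1
  have h2 : R⁻¹ < σ⁻¹ := inv_strictAnti₀ hσ hσR
  exact ⟨sphere_subset_openAnnulus hσR (hR1.trans_lt (h1.trans_lt h2)),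
    sphere_subset_openAnnulus (hσR.trans_le (hR1.trans h1)) h2,
    sphere_subset_openAnnulus (hσR.trans_le hR1) (h1.trans_lt h2)⟩

theorem notMem_outerPoles_of_mem_continuationDomain (hR : 0 < R) {z : Vars m}
    (hz : z ∈ continuationDomain m R) {y : ℂ} (hy : y ∈ sphere (0 : ℂ) R) :
    y ∉ outerPoles z := fun ho => by
  obtain ⟨hb, -, -, hc, -⟩ := (mem_continuationDomain_iff hR).1 hz
  exact (lt_norm_of_mem_outerPoles hb hc ho).ne' (by simpa using hy)

theorem notMem_innerPoles_of_mem_continuationDomain (hR : 0 < R) {z : Vars m}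
    (hz : z ∈ continuationDomain m R) {y : ℂ} (hy : y ∈ sphere (0 : ℂ) R⁻¹) :
    y ∉ innerPoles z := fun ho => by
  obtain ⟨hb, -, -, hc, -⟩ := (mem_continuationDomain_iff hR).1 hz
  exact (norm_lt_of_mem_innerPoles hb hR hc ho).ne (by simpa using hy)

/-- Both splittings are restricted to the annulus of the larger `σ` and compared one variable at a
time. Disjointness of inner and outer poles is essential here, which is why the parameters must be
unpinched. -/
theorem IsContinuationValue.unique (hR : 0 < R) (hR1 : R ≤ 1)
    (hφ : DifferentiableOn ℂ φ {y | ∀ k, y k ≠ 0}) {z : Vars m}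
    (hz : z ∈ continuationDomain m R) (hu : z ∈ unpinched m) {w w' : ℂ}
    (hw : IsContinuationValue φ R z w) (hw' : IsContinuationValue φ R z w') : w = w' := by
  obtain ⟨σ₁, f₁, f₂, hσ₁, hf₁, rfl⟩ := hw
  obtain ⟨σ₂, f₁', f₂', hσ₂, hf₂, rfl⟩ := hw'
  obtain ⟨hb, -, -, hc, -⟩ := (mem_continuationDomain_iff hR).1 hz
  have hσR : max σ₁ σ₂ < R := max_lt hσ₁ hσ₂
  have hf := hf₁.mono (le_max_left σ₁ σ₂)
  have hf' := hf₂.mono (le_max_right σ₁ σ₂)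
  obtain ⟨s1, s2, -⟩ := sphere_subset_openAnnulus_of_lt hR1 hf.pos hσR
  congr 1
  refine iterSplitIntegral_congr (isOpen_openAnnulus _) hR.le (inv_nonneg.2 hR.le) hR.le
    (inv_nonneg.2 hR.le) s1 s2 s1 s2
    (hf.left.mono fun y hy => ⟨s1 hy, notMem_outerPoles_of_mem_continuationDomain hR hz hy⟩)
    (hf.right.mono fun y hy => ⟨s2 hy, notMem_innerPoles_of_mem_continuationDomain hR hz hy⟩)
    (fun g hg => ?_) n (hf.differentiableOn_regularFactor hb hφ)
  exact splitIntegral_eq_splitIntegral hR hR1 hf.pos hσR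
    ((isOpen_openAnnulus _).sdiff (isClosed_outerPoles hb))
    (isOpen_openAnnulus_sdiff_innerPoles hb hf.pos) (disjoint_outerPoles_innerPoles hb hu)
    (fun y hy => lt_norm_of_mem_outerPoles hb hc hy)
    (fun y hy => norm_lt_of_mem_innerPoles hb hR hc hy) hf.left hf.right hf'.left hf'.right
    (fun y hy ho hi => (hf.add_eq y hy ho hi).trans (hf'.add_eq y hy ho hi).symm) g hg

theorem norm_eq_one_notMem_poles {z : Vars m} (hz : z ∈ initialRegion m R) {y : ℂ}
    (hy : ‖y‖ = 1) : y ∉ outerPoles z ∧ y ∉ innerPoles z := by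
  obtain ⟨hb, -, -, hc, -⟩ := norm_kernelParam_lt_one_of_mem_initialRegion hz
  refine ⟨fun h => ?_, fun h => ?_⟩
  · exact (lt_norm_of_mem_outerPoles hb (fun j => by simpa using hc j) h).ne' hy
  · simpa [hy] using norm_lt_of_mem_innerPoles hb one_pos (fun j => by simpa using hc j) h

theorem IsSplitting.continuousOn_oneVarWeight (hR1 : R ≤ 1) {z : Vars m}
    (hz : z ∈ initialRegion m R) {σ : ℝ} (hσR : σ < R) {f₁ f₂ : ℂ → ℂ}
    (hf : IsSplitting σ z f₁ f₂) : ContinuousOn (fun y => oneVarWeight y z) (sphere 0 1) := by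
  obtain ⟨-, -, s1⟩ := sphere_subset_openAnnulus_of_lt hR1 hf.pos hσR
  have hp : ∀ y ∈ sphere (0 : ℂ) 1, y ∉ outerPoles z ∧ y ∉ innerPoles z := fun y hy =>
    norm_eq_one_notMem_poles hz (by simpa using hy)
  refine ((hf.left.continuousOn.mono fun y hy => ⟨s1 hy, (hp y hy).1⟩).add
    (hf.right.continuousOn.mono fun y hy => ⟨s1 hy, (hp y hy).2⟩)).congr fun y hy => ?_
  exact (hf.add_eq y (s1 hy) (hp y hy).1 (hp y hy).2).symm

theorem IsSplitting.continuousOn_regularFactor (hR1 : R ≤ 1)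
    (hφ : DifferentiableOn ℂ φ {y | ∀ k, y k ≠ 0}) {z : Vars m} (hz : z ∈ baseRegion m) {σ : ℝ}
    (hσR : σ < R) {f₁ f₂ : ℂ → ℂ} (hf : IsSplitting σ z f₁ f₂) :
    ContinuousOn (fun y => regularFactor φ y z) {y | ∀ k, ‖y k‖ = 1} :=
  (hf.differentiableOn_regularFactor hz hφ).continuousOn.mono fun _ hy k =>
    (sphere_subset_openAnnulus_of_lt hR1 hf.pos hσR).2.2 (by simpa using hy k)

theorem IsSplitting.torusIntegrable_integrand (hR1 : R ≤ 1)
    (hφ : DifferentiableOn ℂ φ {y | ∀ k, y k ≠ 0}) {x : Fin m → ℂ} {a : Fin 8 → ℂ} {u v τ : ℂ}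
    (hz : (x, a, u, v, τ) ∈ initialRegion m R) {σ : ℝ} (hσR : σ < R) {f₁ f₂ : ℂ → ℂ}
    (hf : IsSplitting σ ((x, a, u, v, τ) : Vars m) f₁ f₂) :
    TorusIntegrable (integrand φ x a u v τ) (0 : Fin n → ℂ) (fun _ => (1 : ℝ)) := by
  have hb := (norm_kernelParam_lt_one_of_mem_initialRegion hz).1
  refine torusIntegrable_of_continuousOn ?_
  refine ((continuousOn_finsetProd Finset.univ fun k _ =>
    (hf.continuousOn_oneVarWeight hR1 hz hσR).comp (f := fun y : Fin n → ℂ => y k)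
      (by fun_prop) fun y hy => by simpa using hy k).mul
    (hf.continuousOn_regularFactor hR1 hφ hb hσR)).congr fun y hy => ?_
  exact integrand_eq hb.2.2.2.2.2.1 hb.2.2.2.2.2.2 hy

/-- Any splitting will do: with `|c_j| < 1` the unit circle itself separates the poles. -/
theorem IsContinuationValue.eq_cauchyTransform (hR : 0 < R) (hR1 : R ≤ 1)
    (hφ : DifferentiableOn ℂ φ {y | ∀ k, y k ≠ 0}) {x : Fin m → ℂ} {a : Fin 8 → ℂ} {u v τ : ℂ}
    (hz : (x, a, u, v, τ) ∈ initialRegion m R) {w : ℂ}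
    (hw : IsContinuationValue φ R ((x, a, u, v, τ) : Vars m) w) :
    w = cauchyTransform φ x a u v τ := by
  obtain ⟨σ, f₁, f₂, hσR, hf, rfl⟩ := hw
  obtain ⟨hb, -, -, hc, -⟩ := norm_kernelParam_lt_one_of_mem_initialRegion hz
  have hD := initialRegion_subset_continuationDomain hR hR1 hz
  obtain ⟨s1, s2, s3⟩ := sphere_subset_openAnnulus_of_lt hR1 hf.pos hσR
  rw [cauchyTransform, torusIntegral_congr fun y hy =>
    integrand_eq hb.2.2.2.2.2.1 hb.2.2.2.2.2.2 hy, torusIntegral_prod_mul_eq_iterSplitIntegral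
      (hf.continuousOn_oneVarWeight hR1 hz hσR) n (hf.continuousOn_regularFactor hR1 hφ hb hσR)]
  congr 1
  refine iterSplitIntegral_congr (isOpen_openAnnulus _) hR.le (inv_nonneg.2 hR.le) zero_le_one
    zero_le_one s1 s2 s3 s3
    (hf.left.mono fun y hy => ⟨s1 hy, notMem_outerPoles_of_mem_continuationDomain hR hD hy⟩)
    (hf.right.mono fun y hy => ⟨s2 hy, notMem_innerPoles_of_mem_continuationDomain hR hD hy⟩)
    (fun g hg => ?_) n (hf.differentiableOn_regularFactor hb hφ)
  refine splitIntegral_eq_circleIntegral hR hR1 hf.pos hσR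
    (fun y hy => lt_norm_of_mem_outerPoles hb (fun j => by simpa using hc j) hy)
    (fun y hy => ?_) hf.left hf.right (fun y hy => ?_) g hg
  · simpa using norm_lt_of_mem_innerPoles hb one_pos (fun j => by simpa using hc j) hy
  · exact hf.add_eq y (s3 (by simpa using hy)) (norm_eq_one_notMem_poles hz hy).1
      (norm_eq_one_notMem_poles hz hy).2

theorem exists_local_splitting (hR : 0 < R) {z₀ : Vars m} (hz₀ : z₀ ∈ continuationDomain m R) :
    ∃ (σ : ℝ) (U : Set (Vars m)) (f₁ f₂ : ℂ × Vars m → ℂ), 0 < σ ∧ σ < R ∧ IsOpen U ∧ z₀ ∈ U ∧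
      U ⊆ continuationDomain m R ∧ (∀ z ∈ U, ‖baseT z‖ < σ ^ 2) ∧
      DifferentiableOn ℂ f₁ {w | w.1 ∈ openAnnulus σ ∧ w.2 ∈ U ∧ w.1 ∉ outerPoles w.2} ∧
      DifferentiableOn ℂ f₂ {w | w.1 ∈ openAnnulus σ ∧ w.2 ∈ U ∧ w.1 ∉ innerPoles w.2} ∧
      ∀ z ∈ U, IsSplitting σ z (fun y => f₁ (y, z)) fun y => f₂ (y, z) := by
  obtain ⟨σ, U, f₁, f₂, hσ, hσR, hU, hzU, hUD, ht, h1, h2, h⟩ := exists_local_decomposition hR hz₀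
  exact ⟨σ, U, f₁, f₂, hσ, hσR, hU, hzU, hUD, ht, h1, h2, fun z hz => ⟨hσ, ht z hz,
    h1.comp (f := fun y : ℂ => (y, z)) (by fun_prop) fun y hy => ⟨hy.1, hz, hy.2⟩,
    h2.comp (f := fun y : ℂ => (y, z)) (by fun_prop) fun y hy => ⟨hy.1, hz, hy.2⟩,
    fun y hy => h y hy z hz⟩⟩

theorem exists_local_continuation (hR : 0 < R) (hR1 : R ≤ 1)
    (hφ : DifferentiableOn ℂ φ {y | ∀ k, y k ≠ 0}) {z₀ : Vars m}
    (hz₀ : z₀ ∈ continuationDomain m R) :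
    ∃ (U : Set (Vars m)) (G : Vars m → ℂ), IsOpen U ∧ z₀ ∈ U ∧ U ⊆ continuationDomain m R ∧
      DifferentiableOn ℂ G U ∧ ∀ z ∈ U, IsContinuationValue φ R z (G z) := by
  obtain ⟨σ, U, f₁, f₂, hσ, hσR, hU, hzU, hUD, ht, h1, h2, hf⟩ := exists_local_splitting hR hz₀
  obtain ⟨s1, s2, -⟩ := sphere_subset_openAnnulus_of_lt hR1 hσ hσR
  refine ⟨U, fun z => ((2 * (Real.pi : ℂ) * Complex.I) ^ n)⁻¹ *
    iterSplitIntegral R R⁻¹ (fun y => f₁ (y, z)) (fun y => f₂ (y, z)) n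
      fun y => regularFactor φ y z, hU, hzU, hUD, ?_, fun z hz => ⟨σ, _, _, hσR, hf z hz, rfl⟩⟩
  refine DifferentiableOn.const_mul ?_ _
  refine differentiableOn_iterSplitIntegral (isOpen_openAnnulus σ) hR.le (inv_nonneg.2 hR.le)
    s1 s2 n hU (H := fun w : (Fin n → ℂ) × Vars m => regularFactor φ w.1 w.2)
    (h1.mono fun w hw => ⟨s1 hw.1, hw.2,
      notMem_outerPoles_of_mem_continuationDomain hR (hUD hw.2) hw.1⟩)
    (h2.mono fun w hw => ⟨s2 hw.1, hw.2,
      notMem_innerPoles_of_mem_continuationDomain hR (hUD hw.2) hw.1⟩)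
    (differentiableOn_regularFactor hφ hσ
      (fun z hz => ((mem_continuationDomain_iff hR).1 (hUD hz)).1) ht)

/-- Each point takes its value from the local continuation centred at it; agreement on overlaps
makes the result holomorphic. -/
theorem exists_continuation (hR : 0 < R) (hR1 : R ≤ 1)
    (hφ : DifferentiableOn ℂ φ {y | ∀ k, y k ≠ 0}) :
    ∃ F : Vars m → ℂ, DifferentiableOn ℂ F (continuationDomain m R) ∧
      ∀ z ∈ continuationDomain m R, IsContinuationValue φ R z (F z) := by
  classical
  choose U G hU hzU hUD hG hval using fun z₀ : continuationDomain m R =>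
    exists_local_continuation hR hR1 hφ z₀.2
  let F : Vars m → ℂ := fun z => if hz : z ∈ continuationDomain m R then G ⟨z, hz⟩ z else 0
  have hF : ∀ z (hz : z ∈ continuationDomain m R), F z = G ⟨z, hz⟩ z := fun z hz => dif_pos hz
  -- At a pinched `z` uniqueness is not available directly, so both values are obtained as limits
  -- along unpinched points of the overlap, where it is.
  have key : ∀ z₁ z₂ z, z ∈ U z₁ → z ∈ U z₂ → G z₁ z = G z₂ z := by
    intro z₁ z₂ z h1 h2
    have hV : IsOpen (U z₁ ∩ U z₂) := (hU z₁).inter (hU z₂)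
    have hcl : z ∈ closure (U z₁ ∩ U z₂ ∩ unpinched m) := by
      rw [mem_closure_iff_nhds]
      intro t ht
      have := mem_closure_iff_nhds.1 (subset_closure_unpinched hR (hUD z₁ h1)) _
        (inter_mem ht (hV.mem_nhds ⟨h1, h2⟩))
      obtain ⟨w, ⟨hw1, hw2⟩, -, hw3⟩ := this
      exact ⟨w, hw1, hw2, hw3⟩
    have hne : (𝓝[U z₁ ∩ U z₂ ∩ unpinched m] z).NeBot := mem_closure_iff_nhdsWithin_neBot.1 hcl
    have hlim : ∀ i, z ∈ U i → Tendsto (G i) (𝓝[U z₁ ∩ U z₂ ∩ unpinched m] z) (𝓝 (G i z)) :=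
      fun i hi => ((hG i).continuousOn.continuousAt ((hU i).mem_nhds hi)).tendsto.mono_left
        nhdsWithin_le_nhds
    refine tendsto_nhds_unique (hlim z₁ h1) ((hlim z₂ h2).congr' ?_)
    filter_upwards [self_mem_nhdsWithin] with w hw
    exact IsContinuationValue.unique hR hR1 hφ (hUD z₁ hw.1.1) hw.2 (hval z₂ w hw.1.2)
      (hval z₁ w hw.1.1)
  refine ⟨F, fun z hz => ?_, fun z hz => hF z hz ▸ hval ⟨z, hz⟩ z (hzU _)⟩
  have hnhds := (hU ⟨z, hz⟩).mem_nhds (hzU ⟨z, hz⟩)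
  refine (((hG ⟨z, hz⟩).differentiableAt hnhds).congr_of_eventuallyEq ?_).differentiableWithinAt
  filter_upwards [hnhds] with w hw
  rw [hF w (hUD _ hw)]
  exact key _ _ w (hzU _) hw

end Gluing

end VanDiejen

end

theorem proposition5p2 {m n : ℕ} (hm : 1 ≤ m) (hn : 1 ≤ n) (R : ℝ) (hR0 : 0 < R) (hR1 : R ≤ 1)
    (φ : (Fin n → ℂ) → ℂ) (hφ : DifferentiableOn ℂ φ {y | ∀ k, y k ≠ 0}) :
    (∀ (x : Fin m → ℂ) (a : Fin 8 → ℂ) (u v τ : ℂ),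
      (x, a, u, v, τ) ∈ VanDiejen.initialRegion m R →
        TorusIntegrable (VanDiejen.integrand φ x a u v τ) (0 : Fin n → ℂ) (fun _ => (1 : ℝ))) ∧
    IsOpen (VanDiejen.continuationDomain m R) ∧
    VanDiejen.initialRegion m R ⊆ VanDiejen.continuationDomain m R ∧
    ∃ F : VanDiejen.Vars m → ℂ,
      DifferentiableOn ℂ F (VanDiejen.continuationDomain m R) ∧
      ∀ (x : Fin m → ℂ) (a : Fin 8 → ℂ) (u v τ : ℂ),
        (x, a, u, v, τ) ∈ VanDiejen.initialRegion m R →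
          F (x, a, u, v, τ) = VanDiejen.cauchyTransform φ x a u v τ := by
  have hsub := VanDiejen.initialRegion_subset_continuationDomain (m := m) hR0 hR1
  refine ⟨fun x a u v τ hz => ?_, VanDiejen.isOpen_continuationDomain hR0, hsub, ?_⟩
  · obtain ⟨σ, U, f₁, f₂, -, hσR, -, hzU, -, -, -, -, hf⟩ :=
      VanDiejen.exists_local_splitting hR0 (hsub hz)
    exact (hf _ hzU).torusIntegrable_integrand hR1 hφ hz hσR
  · obtain ⟨F, hF, hval⟩ := VanDiejen.exists_continuation (m := m) hR0 hR1 hφ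
    exact ⟨F, hF, fun x a u v τ hz => (hval _ (hsub hz)).eq_cauchyTransform hR0 hR1 hφ hz⟩
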